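/- **Theorem 7.1 (Joyal–Kock).** Every braided monoidal category arises, up to braided monoidal equivalence, as $\operatorname{End}(I)$ for a weak unit $I$ in an otherwise completely strict monoidal $2$-category. In detail: A *strict $2$-category with strict tensor product* is a strict $2$-category $\mathscr C$ with a strict $2$-functor $\otimes:\mathscr C\times\mathscr C\to\mathscr C$ that is strictly associative on objects, arrows and $2$-cells. A *weak unit* in it (in the sense of Gordon–Power–Street) consists of an object $I$; pseudo-natural transformations with components $\lambda_X:I\otimes X\to X$ and $\rho_X:X\otimes I\to X$, all of which are equivalences (admit pseudo-inverses); and invertible modifications $$K_{X,Y}:\rho_X\otimes Y\Rightarrow X\otimes\lambda_Y,\qquad \Lambda_{X,Y}:\lambda_{X\otimes Y}\Rightarrow\lambda_X\otimes Y,\qquad P_{X,Y}:\rho_{X\otimes Y}\Rightarrow X\otimes\rho_Y$$ satisfying, for all $X,Y,Z$ (vertical composition, the right-hand factor first), the two normalisation axioms $$(X\otimes\Lambda_{Y,Z})\cdot K_{X,Y\otimes Z}=K_{X,Y}\otimes Z,\qquad (X\otimes K_{Y,Z})\cdot(P_{X,Y}\otimes Z)=K_{X\otimes Y,Z}.$$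 Given a weak unit, put $\alpha:=\lambda_I:I\otimes I\to I$ and let $\kappa:\rho_I\Rightarrow\lambda_I$ be the canonical invertible $2$-cell, i.e. the one for which $\lambda_I\circ(\kappa\otimes I)$ is the composite $$\lambda_I\circ(\rho_I\otimes I)\overset{K_{I,I}}{\Longrightarrow}\lambda_I\circ(I\otimes\lambda_I)\Longrightarrow\lambda_I\circ\lambda_{I\otimes I}\overset{\Lambda_{I,I}}{\Longrightarrow}\lambda_I\circ(\lambda_I\otimes I),$$ whose middle $2$-cell is the naturality of $\lambda$ at $\lambda_I$. Let $\operatorname{End}(I)$ be the category of arrows $I\to I$ and $2$-cells between them, with composition of arrows as (strict) tensor product (the product of $f$ and $g$ being $g\circ f$, first $f$ and then $g$). Its canonical braiding $g\circ f\Rightarrow f\circ g$ is the unique $2$-cell whose whiskering with $\alpha$ is $$g\circ f\circ\alpha\Rightarrow g\circ\alpha\circ(I\otimes f)\Rightarrow\alpha\circ(g\otimes I)\circ(I\otimes f)=\alpha\circ(I\otimes f)\circ(g\otimes I)\Rightarrow f\circ\alpha\circ(g\otimes I)\Rightarrow f\circ g\circ\alpha,$$ where $f$ passes through $\alpha$ by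 the naturality $2$-cell of $\lambda$ at $f$, $g$ passes through $\alpha$ by the naturality $2$-cell of $\rho$ at $g$ conjugated by $\kappa$, and the equality is strict interchange. *Claim.* For every braided monoidal category $\mathscr B$ there exist a strict $2$-category $\mathscr C$ with strict tensor product and a weak unit in $\mathscr C$, with object $I$, such that the canonical $2$-cells above form a braiding on the monoidal category $\operatorname{End}(I)$, and there is a braided (strong) monoidal functor $\mathscr B\to\operatorname{End}(I)$ that is an equivalence of categories. -/

import Mathlib

open CategoryTheory Bicategory

universe w v u

/-- The value of a strict 2-functor `F : C × C → C` on a pair of objects. -/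
abbrev pairObj {C : Type u} [Bicategory.{w, v} C] (F : StrictPseudofunctor (C × C) C)
    (X Y : C) : C :=
  F.obj (X, Y)

/-- The value of a strict 2-functor `F : C × C → C` on a pair of arrows. -/
abbrev pairMap {C : Type u} [Bicategory.{w, v} C] (F : StrictPseudofunctor (C × C) C)
    {X X' Y Y' : C} (f : X ⟶ X') (g : Y ⟶ Y') : pairObj F X Y ⟶ pairObj F X' Y' :=
  F.map (Prod.mkHom f g)

/-- The value of a strict 2-functor `F : C × C → C` on a pair of 2-cells. -/
abbrev pairMap₂ {C : Type u} [Bicategory.{w, v} C] (F : StrictPseudofunctor (C × C) C)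
    {X X' Y Y' : C} {f f' : X ⟶ X'} {g g' : Y ⟶ Y'} (φ : f ⟶ f') (ψ : g ⟶ g') :
    pairMap F f g ⟶ pairMap F f' g' :=
  F.map₂ (a := (X, Y)) (b := (X', Y')) (f := Prod.mkHom f g) (g := Prod.mkHom f' g')
    (Prod.mkHom φ ψ)

/-- A strictly associative tensor product on a strict 2-category `C`: a strict 2-functor
`C × C → C` which is associative on the nose on objects, on arrows and on 2-cells.
No unit is part of this structure. -/
structure StrictTensor (C : Type u) [Bicategory.{w, v} C] [Bicategory.Strict C] where
  /-- the tensor product 2-functor -/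
  functor : StrictPseudofunctor (C × C) C
  obj_assoc (X Y Z : C) :
    pairObj functor (pairObj functor X Y) Z = pairObj functor X (pairObj functor Y Z)
  map_assoc {X X' Y Y' Z Z' : C} (f : X ⟶ X') (g : Y ⟶ Y') (h : Z ⟶ Z') :
    HEq (pairMap functor (pairMap functor f g) h)
      (pairMap functor f (pairMap functor g h))
  map₂_assoc {X X' Y Y' Z Z' : C} {f f' : X ⟶ X'} {g g' : Y ⟶ Y'} {h h' : Z ⟶ Z'}
    (φ : f ⟶ f') (ψ : g ⟶ g') (χ : h ⟶ h') :
    HEq (pairMap₂ functor (pairMap₂ functor φ ψ) χ)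
      (pairMap₂ functor φ (pairMap₂ functor ψ χ))

/-- The 2-cells of `C`, with varying boundary. Equality in this type includes equality of the
boundaries, so that it does not depend on how tensor products are bracketed. -/
structure TwoCell (C : Type u) [Bicategory.{w, v} C] where
  /-- source object -/
  {dom : C}
  /-- target object -/
  {cod : C}
  /-- source arrow -/
  {src : dom ⟶ cod}
  /-- target arrow -/
  {tgt : dom ⟶ cod}
  /-- the 2-cell -/
  cell : src ⟶ tgt

/-- `TwoCell.Comp p q r`: the 2-cells `p` and `q` (in this order) are vertically composable, and
`r` is their composite. -/
inductive TwoCell.Comp {C : Type u} [Bicategory.{w, v} C] :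
    TwoCell C → TwoCell C → TwoCell C → Prop
  | mk {X Y : C} {f g h : X ⟶ Y} (φ : f ⟶ g) (ψ : g ⟶ h) :
      TwoCell.Comp ⟨φ⟩ ⟨ψ⟩ ⟨φ ≫ ψ⟩

/-- `TwoCell.Square p q p' q'`: both vertical composites exist and `p` followed by `q` equals `p'`
followed by `q'`. -/
def TwoCell.Square {C : Type u} [Bicategory.{w, v} C] (p q p' q' : TwoCell C) : Prop :=
  ∃ r, TwoCell.Comp p q r ∧ TwoCell.Comp p' q' r

/-- An arrow of a 2-category is an equimorphism if it admits a pseudo-inverse. -/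
def IsEquimorphism {C : Type u} [Bicategory.{w, v} C] {X Y : C} (f : X ⟶ Y) : Prop :=
  ∃ g : Y ⟶ X, Nonempty (𝟙 X ≅ f ≫ g) ∧ Nonempty (g ≫ f ≅ 𝟙 Y)

namespace StrictTensor

variable {C : Type u} [Bicategory.{w, v} C] [Bicategory.Strict C] (T : StrictTensor C)

/-- The tensor product of objects. -/
abbrev obj (X Y : C) : C := pairObj T.functor X Y

/-- The tensor product of arrows. -/
abbrev map {X X' Y Y' : C} (f : X ⟶ X') (g : Y ⟶ Y') : T.obj X Y ⟶ T.obj X' Y' :=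
  pairMap T.functor f g

/-- The tensor product of 2-cells. -/
abbrev map₂ {X X' Y Y' : C} {f f' : X ⟶ X'} {g g' : Y ⟶ Y'} (φ : f ⟶ f') (ψ : g ⟶ g') :
    T.map f g ⟶ T.map f' g' :=
  pairMap₂ T.functor φ ψ

/-- The identification `(X ⊗ Y) ⊗ Z = X ⊗ (Y ⊗ Z)`, as an arrow. -/
abbrev assoc (X Y Z : C) : T.obj (T.obj X Y) Z ⟶ T.obj X (T.obj Y Z) :=
  eqToHom (T.obj_assoc X Y Z)

/-- Tensoring with `A` from the left, `X ↦ A ⊗ X`. -/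
abbrev tensorLeft (A : C) : Pseudofunctor C C :=
  (Bicategory.Prod.sectR A C).toPseudofunctor.comp T.functor.toPseudofunctor

/-- Tensoring with `A` from the right, `X ↦ X ⊗ A`. -/
abbrev tensorRight (A : C) : Pseudofunctor C C :=
  (Bicategory.Prod.sectL C A).toPseudofunctor.comp T.functor.toPseudofunctor

theorem interchange {X X' Y Y' : C} (f : X ⟶ X') (g : Y ⟶ Y') :
    T.map (𝟙 X) g ≫ T.map f (𝟙 Y') = T.map f (𝟙 Y) ≫ T.map (𝟙 X') g := by
  have h₁ := T.functor.map_comp (Prod.mkHom (𝟙 X) g) (Prod.mkHom f (𝟙 Y'))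
  have h₂ := T.functor.map_comp (Prod.mkHom f (𝟙 Y)) (Prod.mkHom (𝟙 X') g)
  refine h₁.symm.trans (Eq.trans ?_ h₂)
  congr 1
  ext
  · exact (Bicategory.Strict.id_comp f).trans (Bicategory.Strict.comp_id f).symm
  · exact (Bicategory.Strict.comp_id g).trans (Bicategory.Strict.id_comp g).symm

end StrictTensor

/-- A weak unit for a strictly associative tensor product `⊗` on a strict 2-category: the unit
data and axioms of a (one-object, locally strict) tricategory whose composition is strict. -/
structure WeakUnit {C : Type u} [Bicategory.{w, v} C] [Bicategory.Strict C]
    (T : StrictTensor C) where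
  /-- the unit object `I` -/
  unit : C
  /-- the left constraints `λ_X : I ⊗ X ⟶ X`, pseudo-natural in `X` -/
  left : Pseudofunctor.StrongTrans (T.tensorLeft unit) (Pseudofunctor.id C)
  left_equi (X : C) : IsEquimorphism (left.app X)
  /-- the right constraints `ρ_X : X ⊗ I ⟶ X`, pseudo-natural in `X` -/
  right : Pseudofunctor.StrongTrans (T.tensorRight unit) (Pseudofunctor.id C)
  right_equi (X : C) : IsEquimorphism (right.app X)
  /-- the middle (Kelly) 2-cells `K : ρ_X ⊗ Y ⇒ X ⊗ λ_Y` -/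
  kelly (X Y : C) :
    T.map (right.app X) (𝟙 Y) ≅ T.assoc X unit Y ≫ T.map (𝟙 X) (left.app Y)
  /-- the left 2-cells `λ_{X ⊗ Y} ⇒ λ_X ⊗ Y` -/
  leftCell (X Y : C) :
    T.assoc unit X Y ≫ left.app (T.obj X Y) ≅ T.map (left.app X) (𝟙 Y)
  /-- the right 2-cells `ρ_{X ⊗ Y} ⇒ X ⊗ ρ_Y` -/
  rightCell (X Y : C) :
    right.app (T.obj X Y) ≅ T.assoc X Y unit ≫ T.map (𝟙 X) (right.app Y)
  /-- the 2-cells `kelly` form a modification -/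
  kelly_natural {X X' Y Y' : C} (f : X ⟶ X') (g : Y ⟶ Y') :
    TwoCell.Square
      ⟨T.map₂ (right.naturality f).hom (𝟙 g)⟩
      ⟨(kelly X Y).hom ▷ T.map f g⟩
      ⟨T.map (T.map f (𝟙 unit)) g ◁ (kelly X' Y').hom⟩
      ⟨T.map₂ (𝟙 f) (left.naturality g).hom⟩
  /-- the 2-cells `leftCell` form a modification -/
  leftCell_natural {X X' Y Y' : C} (f : X ⟶ X') (g : Y ⟶ Y') :
    TwoCell.Square
      ⟨(left.naturality (T.map f g)).hom⟩
      ⟨(leftCell X Y).hom ▷ T.map f g⟩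
      ⟨T.map (T.map (𝟙 unit) f) g ◁ (leftCell X' Y').hom⟩
      ⟨T.map₂ (left.naturality f).hom (𝟙 g)⟩
  /-- the 2-cells `rightCell` form a modification -/
  rightCell_natural {X X' Y Y' : C} (f : X ⟶ X') (g : Y ⟶ Y') :
    TwoCell.Square
      ⟨(right.naturality (T.map f g)).hom⟩
      ⟨(rightCell X Y).hom ▷ T.map f g⟩
      ⟨T.map (T.map f g) (𝟙 unit) ◁ (rightCell X' Y').hom⟩
      ⟨T.map₂ (𝟙 f) (right.naturality g).hom⟩
  /-- left normalised 4-cocycle condition, on `X ⊗ I ⊗ Y ⊗ Z`: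
  `ρ_X ⊗ Y ⊗ Z ⇒ X ⊗ λ_{Y ⊗ Z} ⇒ X ⊗ λ_Y ⊗ Z` is `K_{X,Y} ⊗ Z` -/
  left_normalised (X Y Z : C) :
    TwoCell.Comp
      ⟨(kelly X (T.obj Y Z)).hom⟩
      ⟨T.map₂ (𝟙 (𝟙 X)) (leftCell Y Z).hom⟩
      ⟨T.map₂ (kelly X Y).hom (𝟙 (𝟙 Z))⟩
  /-- right normalised 4-cocycle condition, on `X ⊗ Y ⊗ I ⊗ Z`:
  `ρ_{X ⊗ Y} ⊗ Z ⇒ X ⊗ ρ_Y ⊗ Z ⇒ X ⊗ Y ⊗ λ_Z` is `K_{X ⊗ Y,Z}` -/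
  right_normalised (X Y Z : C) :
    TwoCell.Comp
      ⟨T.map₂ (rightCell X Y).hom (𝟙 (𝟙 Z))⟩
      ⟨T.map₂ (𝟙 (𝟙 X)) (kelly Y Z).hom⟩
      ⟨(kelly (T.obj X Y) Z).hom⟩

namespace WeakUnit

variable {C : Type u} [Bicategory.{w, v} C] [Bicategory.Strict C] {T : StrictTensor C}
  (W : WeakUnit T)

/-- The arrow `α = λ_I : I ⊗ I ⟶ I`. -/
abbrev alpha : T.obj W.unit W.unit ⟶ W.unit := W.left.app W.unit

/-- The invertible 2-cell `κ : ρ_I ⇒ λ_I` is the canonical one: tensored with `I` from the right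
and followed by `λ_I`, it is the composite
`(ρ_I ⊗ I) ≫ λ_I ⇒ (I ⊗ λ_I) ≫ λ_I ⇒ λ_{I ⊗ I} ≫ λ_I ⇒ (λ_I ⊗ I) ≫ λ_I`
of the Kelly 2-cell, the naturality of `λ` at the arrow `λ_I`, and the left 2-cell. Since `λ_I`
is an equimorphism and tensoring with `I` is locally fully faithful, this determines `κ`. -/
def IsCanonicalKappa (κ : W.right.app W.unit ≅ W.alpha) : Prop :=
  T.map₂ κ.hom (𝟙 (𝟙 W.unit)) ▷ W.alpha =
    (W.kelly W.unit W.unit).hom ▷ W.alpha ≫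
      (α_ _ _ _).hom ≫
      T.assoc W.unit W.unit W.unit ◁ (W.left.naturality W.alpha).hom ≫
      (α_ _ _ _).inv ≫
      (W.leftCell W.unit W.unit).hom ▷ W.alpha

/-- An endo-arrow `f` of `I` passes through `α` from the right-hand strand:
`(I ⊗ f) ≫ α ≅ α ≫ f`. -/
abbrev rightStrand (f : W.unit ⟶ W.unit) :
    T.map (𝟙 W.unit) f ≫ W.alpha ≅ W.alpha ≫ f :=
  W.left.naturality f

/-- An endo-arrow `g` of `I` passes through `α` from the left-hand strand:
`(g ⊗ I) ≫ α ≅ α ≫ g`. -/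
abbrev leftStrand (κ : W.right.app W.unit ≅ W.alpha) (g : W.unit ⟶ W.unit) :
    T.map g (𝟙 W.unit) ≫ W.alpha ≅ W.alpha ≫ g :=
  whiskerLeftIso (T.map g (𝟙 W.unit)) κ.symm ≪≫ W.right.naturality g ≪≫ whiskerRightIso κ g

/-- The 2-cell `α ≫ f ≫ g ⇒ α ≫ g ≫ f` obtained by moving `f` into the right-hand strand and
`g` into the left-hand strand, where they move past each other by strict interchange, and moving
them out of the strands again. -/
def exchange (κ : W.right.app W.unit ≅ W.alpha) (f g : W.unit ⟶ W.unit) :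
    W.alpha ≫ f ≫ g ≅ W.alpha ≫ g ≫ f :=
  (α_ _ _ _).symm ≪≫
    whiskerRightIso (W.rightStrand f).symm g ≪≫
    α_ _ _ _ ≪≫
    whiskerLeftIso (T.map (𝟙 W.unit) f) (W.leftStrand κ g).symm ≪≫
    (α_ _ _ _).symm ≪≫
    whiskerRightIso (eqToIso (T.interchange g f)) W.alpha ≪≫
    α_ _ _ _ ≪≫
    whiskerLeftIso (T.map g (𝟙 W.unit)) (W.rightStrand f) ≪≫
    (α_ _ _ _).symm ≪≫
    whiskerRightIso (W.leftStrand κ g) f ≪≫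
    α_ _ _ _

/-- A braiding on the monoidal category `End(I)` (arrows `I ⟶ I` and their 2-cells, with
composition of arrows as tensor product) is the canonical one if the component at `(f, g)` is the
2-cell `f ≫ g ⇒ g ≫ f` whose whiskering with `α` is `exchange`. As `α` is an equimorphism, this
determines the braiding. -/
def IsCanonicalBraiding (β : BraidedCategory (EndMonoidal W.unit)) : Prop :=
  ∃ κ : W.right.app W.unit ≅ W.alpha, W.IsCanonicalKappa κ ∧
    ∀ f g : W.unit ⟶ W.unit, W.alpha ◁ (β.braiding f g).hom = (W.exchange κ f g).hom

end WeakUnit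

/-!
An object of the 2-category is a number `n ≥ 1` of parallel strands. A labelling puts a word of
objects of `B` on every strand, and an arrow is a map `f` of labellings that is right linear up to a
specified isomorphism: the word of `f x` is that of `x` followed by the *weight* of `f`. A 2-cell is
a morphism of `B` between weights. Words form a free monoid, so composition and juxtaposition are
strictly associative, although `B` is not strict. To juxtapose two arrows, the weight of the first
has to be moved past the labels of the second strands, which is done by the braiding of `B`.

As there is no object with zero strands, the unit for juxtaposition is a single strand, and the unit
constraints move all labels to the first strand. These arrows have trivial weight, and so all the
required 2-cells can be chosen to be identities of words. Taking an endomorphism of the single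
strand to the object that its weight spells is an equivalence with `B`. Finally, `I ⊗ f` followed
by `g ⊗ I` differs from the composite in the other order by the braiding of the weights, which is
why the canonical 2-cell is the braiding of `B`.
-/

theorem nonempty_braided_inverse {C D : Type*} [Category* C] [Category* D] [MonoidalCategory C]
    [MonoidalCategory D] [BraidedCategory C] [BraidedCategory D] (e : C ≌ D) [e.functor.Braided] :
    Nonempty e.inverse.Braided := by
  let := e.inverseMonoidal
  have hμ (X Y : D) : Functor.LaxMonoidal.μ e.inverse X Y = e.toAdjunction.homEquiv _ _
      (Functor.OplaxMonoidal.δ e.functor _ _ ≫ MonoidalCategory.tensorHom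
        (e.toAdjunction.counit.app X) (e.toAdjunction.counit.app Y)) := rfl
  refine ⟨{ braided := fun X Y => ?_ }⟩
  rw [hμ, hμ, ← Adjunction.homEquiv_naturality_right, ← Adjunction.homEquiv_naturality_left]
  congr 1
  simp

namespace StrictTensor

variable {C : Type u} [Bicategory.{w, v} C] [Bicategory.Strict C] (T : StrictTensor C)
  {X X' X'' Y Y' Y'' Z Z' : C}

theorem map_id : T.map (𝟙 X) (𝟙 Y) = 𝟙 (T.obj X Y) :=
  T.functor.map_id (X, Y)

theorem map_comp (f : X ⟶ X') (f' : X' ⟶ X'') (g : Y ⟶ Y') (g' : Y' ⟶ Y'') :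
    T.map (f ≫ f') (g ≫ g') = T.map f g ≫ T.map f' g' :=
  T.functor.map_comp (Prod.mkHom f g) (Prod.mkHom f' g')

theorem map_comp_left (f : X ⟶ X') (f' : X' ⟶ X'') (g : Y ⟶ Y') :
    T.map (f ≫ f') g = T.map f g ≫ T.map f' (𝟙 Y') := by
  rw [← map_comp, Category.comp_id]

theorem map_comp_left' (f : X ⟶ X') (f' : X' ⟶ X'') (g : Y ⟶ Y') :
    T.map (f ≫ f') g = T.map f (𝟙 Y) ≫ T.map f' g := by
  rw [← map_comp, Category.id_comp]

theorem map_comp_right (f : X ⟶ X') (g : Y ⟶ Y') (g' : Y' ⟶ Y'') :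
    T.map f (g ≫ g') = T.map f g ≫ T.map (𝟙 X') g' := by
  rw [← map_comp, Category.comp_id]

theorem map_comp_right' (f : X ⟶ X') (g : Y ⟶ Y') (g' : Y' ⟶ Y'') :
    T.map f (g ≫ g') = T.map (𝟙 X) g ≫ T.map f g' := by
  rw [← map_comp, Category.id_comp]

theorem map_map_eq (f : X ⟶ X') (g : Y ⟶ Y') (h : Z ⟶ Z') :
    T.map (T.map f g) h = T.assoc X Y Z ≫ T.map f (T.map g h) ≫
      eqToHom (T.obj_assoc X' Y' Z').symm :=
  (conj_eqToHom_iff_heq _ _ _ (T.obj_assoc X' Y' Z')).2 (T.map_assoc f g h)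

theorem map_comp_assoc (f : X ⟶ X') (g : Y ⟶ Y') (h : Z ⟶ Z') :
    T.map (T.map f g) h ≫ T.assoc X' Y' Z' = T.assoc X Y Z ≫ T.map f (T.map g h) := by
  rw [map_map_eq, Category.assoc, Category.assoc, eqToHom_trans, eqToHom_refl, Category.comp_id]

theorem arrow_map_assoc (f : X ⟶ X') (g : Y ⟶ Y') (h : Z ⟶ Z') :
    Arrow.mk (T.map (T.map f g) h) = Arrow.mk (T.map f (T.map g h)) :=
  (Arrow.mk_eq_mk_iff _ _).2 ⟨T.obj_assoc X Y Z, T.obj_assoc X' Y' Z', T.map_map_eq f g h⟩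

theorem arrow_map_comp_assoc {V : C} (f : X ⟶ X') (g : Y ⟶ Y') (h : Z ⟶ Z')
    (k : T.obj X' (T.obj Y' Z') ⟶ V) :
    Arrow.mk (T.map (T.map f g) h ≫ T.assoc X' Y' Z' ≫ k) =
      Arrow.mk (T.map f (T.map g h) ≫ k) := by
  rw [← Category.assoc, map_comp_assoc, Category.assoc, Arrow.arrow_mk_eqToHom_comp]

theorem arrow_map_comp_assoc_comp_map {V : C} (f : X ⟶ X') (g : Y ⟶ Y') (h : Z ⟶ Z')
    (k : T.obj Y' Z' ⟶ V) :
    Arrow.mk (T.map (T.map f g) h ≫ T.assoc X' Y' Z' ≫ T.map (𝟙 X') k) =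
      Arrow.mk (T.map f (T.map g h ≫ k)) := by
  rw [arrow_map_comp_assoc, map_comp_right]

theorem arrow_assoc_comp_map {X₁ X₂ Y₁ Y₂ : C} (p : T.obj X (T.obj Y Z) ⟶ T.obj X₁ Y₁)
    (f : X₁ ⟶ X₂) (g : Y₁ ⟶ Y₂) :
    Arrow.mk ((T.assoc X Y Z ≫ p) ≫ T.map f g) = Arrow.mk (p ≫ T.map f g) := by
  rw [Category.assoc, Arrow.arrow_mk_eqToHom_comp]

theorem arrow_map_eqToHom_comp_left (e : X = X') (f : X' ⟶ X'') (g : Y ⟶ Y') :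
    Arrow.mk (T.map (eqToHom e ≫ f) g) = Arrow.mk (T.map f g) := by
  subst e
  rw [eqToHom_refl, Category.id_comp]

theorem arrow_map_eqToHom_comp_right (f : X ⟶ X') (e : Y = Y') (g : Y' ⟶ Y'') :
    Arrow.mk (T.map f (eqToHom e ≫ g)) = Arrow.mk (T.map f g) := by
  subst e
  rw [eqToHom_refl, Category.id_comp]

end StrictTensor

section Pasting

variable {C : Type u} [Bicategory.{w, v} C] {X Y Z X' Y' Z' : C}

/-- The pasting of two invertible 2-cells along the arrow `q`. -/
def pasteIso {p : X ⟶ X'} {q : Y ⟶ Y'} {r : Z ⟶ Z'} {f : X ⟶ Y} {g : Y ⟶ Z} {f' : X' ⟶ Y'}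
    {g' : Y' ⟶ Z'} (η : f ≫ q ≅ p ≫ f') (θ : g ≫ r ≅ q ≫ g') : f ≫ g ≫ r ≅ (p ≫ f') ≫ g' :=
  whiskerLeftIso f θ ≪≫ (α_ f q g').symm ≪≫ whiskerRightIso η g'

theorem WeakUnit.exchange_eq [Bicategory.Strict C] {T : StrictTensor C} (W : WeakUnit T)
    (κ : W.right.app W.unit ≅ W.alpha) (f g : W.unit ⟶ W.unit) :
    W.exchange κ f g = (α_ W.alpha f g).symm ≪≫
      (pasteIso (W.rightStrand f) (W.leftStrand κ g)).symm ≪≫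
      ((α_ _ _ _).symm ≪≫ whiskerRightIso (eqToIso (T.interchange g f)) W.alpha ≪≫ α_ _ _ _) ≪≫
      pasteIso (W.leftStrand κ g) (W.rightStrand f) ≪≫ α_ W.alpha g f := by
  ext
  simp [exchange, pasteIso]

end Pasting

/-! ### Morphisms between words -/

section Words

open scoped MonoidalCategory

variable {B : Type u} [Category.{v} B] [MonoidalCategory B]

/-- The tensor product of a list of objects, bracketed to the right and ending in the unit. -/
def tensorList : List B → B
  | [] => 𝟙_ B
  | x :: a => x ⊗ tensorList a

/-- The coherence isomorphism from the product of two tensor products to that of the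
concatenation. -/
def appendIso : (a b : List B) → (tensorList a ⊗ tensorList b ≅ tensorList (a ++ b))
  | [], b => λ_ (tensorList b)
  | x :: a, b =>
    α_ x (tensorList a) (tensorList b) ≪≫ MonoidalCategory.whiskerLeftIso x (appendIso a b)

theorem eqToHom_tensorList_cons (x : B) {a b : List B} (h : a = b) (h' : x :: a = x :: b) :
    eqToHom (congrArg tensorList h') = x ◁ eqToHom (congrArg tensorList h) := by
  subst h
  exact (MonoidalCategory.whiskerLeft_id x (tensorList a)).symm

theorem appendIso_nil_right (a : List B) :
    (appendIso a []).hom ≫ eqToHom (congrArg tensorList a.append_nil) =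
      (ρ_ (tensorList a)).hom := by
  induction a with
  | nil => simpa [appendIso, tensorList] using MonoidalCategory.unitors_equal
  | cons x a ih =>
    rw [eqToHom_tensorList_cons x a.append_nil (x :: a).append_nil]
    change ((α_ x (tensorList a) (tensorList [])).hom ≫ x ◁ (appendIso a []).hom) ≫ x ◁ _ =
      (ρ_ (x ⊗ tensorList a)).hom
    rw [Category.assoc, ← MonoidalCategory.whiskerLeft_comp, ih]
    exact (MonoidalCategory.rightUnitor_tensor_hom _ _).symm

theorem appendIso_assoc (a b c : List B) :
    (appendIso a b).hom ▷ tensorList c ≫ (appendIso (a ++ b) c).hom ≫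
        eqToHom (congrArg tensorList (a.append_assoc b c)) =
      (α_ (tensorList a) (tensorList b) (tensorList c)).hom ≫
        tensorList a ◁ (appendIso b c).hom ≫ (appendIso a (b ++ c)).hom := by
  induction a with
  | nil => simp [appendIso, tensorList]
  | cons x a ih =>
    rw [eqToHom_tensorList_cons x (a.append_assoc b c) ((x :: a).append_assoc b c)]
    change ((α_ x (tensorList a) (tensorList b)).hom ≫ x ◁ (appendIso a b).hom) ▷ tensorList c ≫
      ((α_ x (tensorList (a ++ b)) (tensorList c)).hom ≫ x ◁ (appendIso (a ++ b) c).hom) ≫ x ◁ _ =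
      (α_ (x ⊗ tensorList a) (tensorList b) (tensorList c)).hom ≫
        (x ⊗ tensorList a) ◁ (appendIso b c).hom ≫
        (α_ x (tensorList a) (tensorList (b ++ c))).hom ≫ x ◁ (appendIso a (b ++ c)).hom
    simp only [MonoidalCategory.comp_whiskerRight,
      MonoidalCategory.associator_naturality_middle_assoc, Category.assoc,
      ← MonoidalCategory.whiskerLeft_comp, ih]
    simp

/-- The object of `B` spelled by a word. -/
abbrev tensorWord (a : FreeMonoid B) : B := tensorList a.toList

/-- `appendIso` for words. -/
abbrev mulIso (a b : FreeMonoid B) : tensorWord a ⊗ tensorWord b ≅ tensorWord (a * b) :=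
  appendIso a.toList b.toList

theorem mulIso_one (a : FreeMonoid B) :
    (mulIso a 1).hom ≫ eqToHom (congrArg tensorWord (mul_one a)) = (ρ_ (tensorWord a)).hom :=
  appendIso_nil_right a.toList

theorem mulIso_assoc (a b c : FreeMonoid B) :
    (mulIso a b).hom ▷ tensorWord c ≫ (mulIso (a * b) c).hom ≫
        eqToHom (congrArg tensorWord (mul_assoc a b c)) =
      (α_ (tensorWord a) (tensorWord b) (tensorWord c)).hom ≫
        tensorWord a ◁ (mulIso b c).hom ≫ (mulIso a (b * c)).hom :=
  appendIso_assoc a.toList b.toList c.toList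

/-- A morphism of `B` between objects spelled by words. Source and target are fields, so that an
equality of such morphisms does not mention the coherence isomorphisms between the differently
bracketed products of words, and tensor products become strictly associative. -/
structure WordHom (B : Type u) [Category.{v} B] [MonoidalCategory B] where
  /-- source word -/
  dom : FreeMonoid B
  /-- target word -/
  cod : FreeMonoid B
  /-- the morphism -/
  hom : tensorWord dom ⟶ tensorWord cod

namespace WordHom

/-- The morphism of words that corresponds to `φ : P ⟶ Q` when `P` and `Q` are identified with the
objects spelled by `a` and `b`. -/
def conj {a b : FreeMonoid B} {P Q : B} (p : P ≅ tensorWord a) (q : Q ≅ tensorWord b)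
    (φ : P ⟶ Q) : WordHom B :=
  ⟨a, b, p.inv ≫ φ ≫ q.hom⟩

theorem conj_refl_refl {a b : FreeMonoid B} (φ : tensorWord a ⟶ tensorWord b) :
    conj (Iso.refl _) (Iso.refl _) φ = ⟨a, b, φ⟩ := by
  simp [conj]

theorem eq_conj (φ : WordHom B) : φ = conj (Iso.refl _) (Iso.refl _) φ.hom :=
  (conj_refl_refl φ.hom).symm

theorem conj_eq_conj {a a' b b' : FreeMonoid B} {P Q : B} {p : P ≅ tensorWord a}
    {p' : P ≅ tensorWord a'} {q : Q ≅ tensorWord b} {q' : Q ≅ tensorWord b'} (φ : P ⟶ Q)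
    (ha : a = a') (hp : p.hom ≫ eqToHom (congrArg tensorWord ha) = p'.hom)
    (hb : b = b') (hq : q.hom ≫ eqToHom (congrArg tensorWord hb) = q'.hom) :
    conj p q φ = conj p' q' φ := by
  subst ha hb
  obtain rfl : p = p' := Iso.ext (by simpa using hp)
  obtain rfl : q = q' := Iso.ext (by simpa using hq)
  rfl

theorem conj_trans {a b : FreeMonoid B} {P P' Q Q' : B} (i : P ≅ P') (p : P' ≅ tensorWord a)
    (j : Q ≅ Q') (q : Q' ≅ tensorWord b) (φ : P ⟶ Q) :
    conj (i ≪≫ p) (j ≪≫ q) φ = conj p q (i.inv ≫ φ ≫ j.hom) := by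
  simp [conj]

/-- The identity of the object spelled by `a`. -/
def id (a : FreeMonoid B) : WordHom B := ⟨a, a, 𝟙 _⟩

instance isIso_hom_conj {a b : FreeMonoid B} {P Q : B} (p : P ≅ tensorWord a) (q : Q ≅ tensorWord b)
    (φ : P ⟶ Q) [IsIso φ] : IsIso (conj p q φ).hom :=
  inferInstanceAs (IsIso (p.inv ≫ φ ≫ q.hom))

theorem conj_id {a : FreeMonoid B} {P : B} (p : P ≅ tensorWord a) : conj p p (𝟙 P) = id a := by
  simp [conj, id]

open Classical in
/-- Composition, in diagrammatic order. If the target of `φ` is not the source of `ψ`, the value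
is `φ`. -/
noncomputable def comp (φ ψ : WordHom B) : WordHom B :=
  if h : φ.cod = ψ.dom then
    ⟨φ.dom, ψ.cod, φ.hom ≫ eqToHom (congrArg tensorWord h) ≫ ψ.hom⟩
  else φ

infixr:69 "⊚" => WordHom.comp

theorem comp_mk {a b c : FreeMonoid B} (φ : tensorWord a ⟶ tensorWord b)
    (ψ : tensorWord b ⟶ tensorWord c) :
    (⟨a, b, φ⟩ : WordHom B) ⊚ ⟨b, c, ψ⟩ = ⟨a, c, φ ≫ ψ⟩ := by
  simp [comp]

theorem conj_comp_conj {a b c : FreeMonoid B} {P Q R : B} (p : P ≅ tensorWord a)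
    (q : Q ≅ tensorWord b) (r : R ≅ tensorWord c) (φ : P ⟶ Q) (ψ : Q ⟶ R) :
    conj p q φ ⊚ conj q r ψ = conj p r (φ ≫ ψ) := by
  simp [conj, comp]

@[simp] theorem dom_comp (φ ψ : WordHom B) : (φ ⊚ ψ).dom = φ.dom := by
  unfold comp; split <;> rfl

theorem cod_comp {φ ψ : WordHom B} (h : φ.cod = ψ.dom) : (φ ⊚ ψ).cod = ψ.cod := by
  simp [comp, h]

@[simp] theorem dom_id (a : FreeMonoid B) : (id a).dom = a := (rfl)

@[simp] theorem cod_id (a : FreeMonoid B) : (id a).cod = a := (rfl)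

theorem comp_assoc {φ ψ χ : WordHom B} (h : φ.cod = ψ.dom) (h' : ψ.cod = χ.dom) :
    (φ ⊚ ψ) ⊚ χ = φ ⊚ ψ ⊚ χ := by
  obtain ⟨a, b, φ⟩ := φ
  obtain ⟨_, c, ψ⟩ := ψ
  obtain ⟨_, d, χ⟩ := χ
  subst h h'
  simp only [comp_mk, Category.assoc]

theorem id_comp {a : FreeMonoid B} {φ : WordHom B} (h : φ.dom = a) : id a ⊚ φ = φ := by
  subst h
  exact (comp_mk _ _).trans (congrArg (mk φ.dom φ.cod) (Category.id_comp _))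

theorem comp_id {φ : WordHom B} {a : FreeMonoid B} (h : φ.cod = a) : φ ⊚ id a = φ := by
  subst h
  exact (comp_mk _ _).trans (congrArg (mk φ.dom φ.cod) (Category.comp_id _))

instance : Mul (WordHom B) where
  mul φ ψ := conj (mulIso φ.dom ψ.dom) (mulIso φ.cod ψ.cod) (φ.hom ⊗ₘ ψ.hom)

instance : One (WordHom B) := ⟨id 1⟩

@[simp] theorem dom_mul (φ ψ : WordHom B) : (φ * ψ).dom = φ.dom * ψ.dom := (rfl)

@[simp] theorem cod_mul (φ ψ : WordHom B) : (φ * ψ).cod = φ.cod * ψ.cod := (rfl)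

theorem conj_mul_conj {a b a' b' : FreeMonoid B} {P Q P' Q' : B} (p : P ≅ tensorWord a)
    (q : Q ≅ tensorWord b) (p' : P' ≅ tensorWord a') (q' : Q' ≅ tensorWord b') (φ : P ⟶ Q)
    (ψ : P' ⟶ Q') :
    conj p q φ * conj p' q' ψ = conj (MonoidalCategory.tensorIso p p' ≪≫ mulIso a a')
      (MonoidalCategory.tensorIso q q' ≪≫ mulIso b b') (φ ⊗ₘ ψ) := by
  rw [conj_trans]
  change conj _ _ _ = conj _ _ _
  simp [conj, MonoidalCategory.tensorHom_comp_tensorHom]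

/-- The identification of a threefold product with the word `a * b * c`. -/
abbrev mulIso₃ (a b c : FreeMonoid B) :
    (tensorWord a ⊗ tensorWord b) ⊗ tensorWord c ≅ tensorWord (a * b * c) :=
  MonoidalCategory.tensorIso (mulIso a b) (Iso.refl _) ≪≫ mulIso (a * b) c

/-- The identification of a threefold product with the word `a * (b * c)`. -/
abbrev mulIso₃' (a b c : FreeMonoid B) :
    tensorWord a ⊗ tensorWord b ⊗ tensorWord c ≅ tensorWord (a * (b * c)) :=
  MonoidalCategory.tensorIso (Iso.refl _) (mulIso b c) ≪≫ mulIso a (b * c)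

theorem conj_mulIso₃_left {a b c d : FreeMonoid B} {Q : B} (q : Q ≅ tensorWord d)
    (φ : (tensorWord a ⊗ tensorWord b) ⊗ tensorWord c ⟶ Q) :
    conj (mulIso₃ a b c) q φ =
      conj (mulIso₃' a b c) q ((α_ (tensorWord a) (tensorWord b) (tensorWord c)).inv ≫ φ) := by
  have h := conj_trans (α_ (tensorWord a) (tensorWord b) (tensorWord c)) (mulIso₃' a b c)
    (Iso.refl Q) q φ
  simp only [Iso.refl_trans, Iso.refl_hom, Category.comp_id] at h
  rw [← h]
  refine conj_eq_conj φ (mul_assoc a b c) ?_ rfl (Category.comp_id _)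
  simpa using mulIso_assoc a b c

theorem conj_mulIso₃_right {a b c d : FreeMonoid B} {P : B} (p : P ≅ tensorWord d)
    (φ : P ⟶ (tensorWord a ⊗ tensorWord b) ⊗ tensorWord c) :
    conj p (mulIso₃ a b c) φ =
      conj p (mulIso₃' a b c) (φ ≫ (α_ (tensorWord a) (tensorWord b) (tensorWord c)).hom) := by
  have h := conj_trans (Iso.refl P) p (α_ (tensorWord a) (tensorWord b) (tensorWord c))
    (mulIso₃' a b c) φ
  simp only [Iso.refl_trans, Iso.refl_inv, Category.id_comp] at h
  rw [← h]
  refine conj_eq_conj φ rfl (Category.comp_id _) (mul_assoc a b c) ?_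
  simpa using mulIso_assoc a b c

theorem mul_mul_eq_conj (φ ψ χ : WordHom B) :
    φ * ψ * χ = conj (mulIso₃ φ.dom ψ.dom χ.dom) (mulIso₃ φ.cod ψ.cod χ.cod)
      ((φ.hom ⊗ₘ ψ.hom) ⊗ₘ χ.hom) := by
  nth_rewrite 1 [χ.eq_conj]
  exact conj_mul_conj _ _ _ _ _ _

theorem mul_mul_eq_conj' (φ ψ χ : WordHom B) :
    φ * (ψ * χ) = conj (mulIso₃' φ.dom ψ.dom χ.dom) (mulIso₃' φ.cod ψ.cod χ.cod)
      (φ.hom ⊗ₘ ψ.hom ⊗ₘ χ.hom) := by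
  nth_rewrite 1 [φ.eq_conj]
  exact conj_mul_conj _ _ _ _ _ _

instance : Monoid (WordHom B) where
  one_mul φ := by
    have h : conj (mulIso 1 φ.dom) (mulIso 1 φ.cod) (𝟙 (𝟙_ B) ⊗ₘ φ.hom) =
        conj (λ_ (tensorWord φ.dom) ≪≫ Iso.refl _) (λ_ (tensorWord φ.cod) ≪≫ Iso.refl _)
          (𝟙 (𝟙_ B) ⊗ₘ φ.hom) := by
      simp only [Iso.trans_refl]; rfl
    refine h.trans ?_
    rw [conj_trans, φ.eq_conj]
    simp [conj]
  mul_one φ := by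
    have h : conj (mulIso φ.dom 1) (mulIso φ.cod 1) (φ.hom ⊗ₘ 𝟙 (𝟙_ B)) =
        conj (ρ_ (tensorWord φ.dom) ≪≫ Iso.refl _) (ρ_ (tensorWord φ.cod) ≪≫ Iso.refl _)
          (φ.hom ⊗ₘ 𝟙 (𝟙_ B)) := by
      refine conj_eq_conj _ (mul_one _) ?_ (mul_one _) ?_
      · simpa using mulIso_one φ.dom
      · simpa using mulIso_one φ.cod
    refine h.trans ?_
    rw [conj_trans, φ.eq_conj]
    simp [conj]
  mul_assoc φ ψ χ := by
    rw [mul_mul_eq_conj, conj_mulIso₃_left, conj_mulIso₃_right, Category.assoc,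
      MonoidalCategory.associator_naturality, Iso.inv_hom_id_assoc, mul_mul_eq_conj']

theorem id_one : id (1 : FreeMonoid B) = 1 := rfl

theorem id_mul (a b : FreeMonoid B) : id (a * b) = id a * id b := by
  have h : id a * id b = conj (mulIso a b) (mulIso a b) (𝟙 (tensorWord a) ⊗ₘ 𝟙 (tensorWord b)) :=
    rfl
  rw [h, MonoidalCategory.id_tensorHom_id, conj_id]

theorem mul_comp_mul {φ ψ φ' ψ' : WordHom B} (h : φ.cod = ψ.dom) (h' : φ'.cod = ψ'.dom) :
    (φ * φ') ⊚ (ψ * ψ') = (φ ⊚ ψ) * (φ' ⊚ ψ') := by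
  obtain ⟨a, b, φ⟩ := φ
  obtain ⟨_, c, ψ⟩ := ψ
  obtain ⟨a', b', φ'⟩ := φ'
  obtain ⟨_, c', ψ'⟩ := ψ'
  subst h h'
  rw [comp_mk, comp_mk]
  exact (conj_comp_conj _ _ _ _ _).trans
    (congrArg (conj _ _) (MonoidalCategory.tensorHom_comp_tensorHom _ _ _ _))

theorem id_mul_comp {φ ψ : WordHom B} (a : FreeMonoid B) (h : φ.cod = ψ.dom) :
    id a * (φ ⊚ ψ) = (id a * φ) ⊚ (id a * ψ) := by
  rw [mul_comp_mul rfl h, id_comp (dom_id a)]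

theorem comp_mul_id {φ ψ : WordHom B} (a : FreeMonoid B) (h : φ.cod = ψ.dom) :
    (φ ⊚ ψ) * id a = (φ * id a) ⊚ (ψ * id a) := by
  rw [mul_comp_mul h rfl, id_comp (dom_id a)]

theorem mul_eq_left_comp_right (φ ψ : WordHom B) :
    φ * ψ = (φ * id ψ.dom) ⊚ (id φ.cod * ψ) := by
  rw [mul_comp_mul rfl rfl, comp_id rfl, id_comp rfl]

theorem mul_eq_right_comp_left (φ ψ : WordHom B) :
    φ * ψ = (id φ.dom * ψ) ⊚ (φ * id ψ.cod) := by
  rw [mul_comp_mul rfl rfl, comp_id rfl, id_comp rfl]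

instance (a : FreeMonoid B) : IsIso (id a).hom := inferInstanceAs (IsIso (𝟙 _))

instance (φ ψ : WordHom B) [IsIso φ.hom] [IsIso ψ.hom] : IsIso (φ * ψ).hom :=
  isIso_hom_conj _ _ (φ.hom ⊗ₘ ψ.hom)

instance (φ ψ : WordHom B) [IsIso φ.hom] [IsIso ψ.hom] : IsIso (φ ⊚ ψ).hom := by
  by_cases h : φ.cod = ψ.dom
  · rw [comp, dif_pos h]
    infer_instance
  · rwa [comp, dif_neg h]

/-- The inverse of an isomorphism between words. -/
noncomputable def inv (φ : WordHom B) [IsIso φ.hom] : WordHom B :=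
  ⟨φ.cod, φ.dom, CategoryTheory.inv φ.hom⟩

@[simp] theorem dom_inv (φ : WordHom B) [IsIso φ.hom] : (inv φ).dom = φ.cod := (rfl)

@[simp] theorem cod_inv (φ : WordHom B) [IsIso φ.hom] : (inv φ).cod = φ.dom := (rfl)

instance (φ : WordHom B) [IsIso φ.hom] : IsIso (inv φ).hom :=
  inferInstanceAs (IsIso (CategoryTheory.inv φ.hom))

theorem comp_inv (φ : WordHom B) [IsIso φ.hom] : φ ⊚ inv φ = id φ.dom :=
  (comp_mk _ _).trans (congrArg (mk φ.dom φ.dom) (IsIso.hom_inv_id φ.hom))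

theorem inv_comp (φ : WordHom B) [IsIso φ.hom] : inv φ ⊚ φ = id φ.cod :=
  (comp_mk _ _).trans (congrArg (mk φ.cod φ.cod) (IsIso.inv_hom_id φ.hom))

theorem comp_inv_comp {φ ψ : WordHom B} [IsIso φ.hom] (h : φ.dom = ψ.dom) :
    φ ⊚ inv φ ⊚ ψ = ψ := by
  rw [← comp_assoc rfl h, comp_inv, id_comp h.symm]

theorem inv_comp_comp {φ ψ : WordHom B} [IsIso φ.hom] (h : φ.cod = ψ.dom) :
    inv φ ⊚ φ ⊚ ψ = ψ := by
  rw [← comp_assoc rfl h, inv_comp, id_comp h.symm]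

theorem comp_left_cancel (φ : WordHom B) [IsIso φ.hom] {ψ χ : WordHom B} (hψ : φ.cod = ψ.dom)
    (hχ : φ.cod = χ.dom) (h : φ ⊚ ψ = φ ⊚ χ) : ψ = χ := by
  rw [← inv_comp_comp hψ, h, inv_comp_comp hχ]

section Coherence

variable {a b c : FreeMonoid B} {P Q : B}

theorem conj_injective (p : P ≅ tensorWord a) (q : Q ≅ tensorWord b) :
    Function.Injective (conj p q) := fun φ ψ h => by
  simpa [conj] using h

theorem conj_eqToHom_comp_hom (φ : WordHom B) (p : P ≅ tensorWord a) (hd : a = φ.dom)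
    (hc : φ.cod = b) :
    conj p (Iso.refl _) (p.hom ≫ eqToHom (congrArg tensorWord hd) ≫ φ.hom ≫
      eqToHom (congrArg tensorWord hc)) = φ := by
  subst hd hc
  simp [conj]

theorem conj_mul_id (p : P ≅ tensorWord a) (φ : P ⟶ tensorWord b) (c : FreeMonoid B) :
    conj p (Iso.refl _) φ * id c =
      conj (MonoidalCategory.tensorIso p (Iso.refl _) ≪≫ mulIso a c) (mulIso b c)
        (φ ▷ tensorWord c) := by
  rw [(id c).eq_conj]
  refine (conj_mul_conj _ _ _ _ _ _).trans ?_
  simp [conj, id]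

theorem id_mul_conj (p : P ≅ tensorWord a) (φ : P ⟶ tensorWord b) (c : FreeMonoid B) :
    id c * conj p (Iso.refl _) φ =
      conj (MonoidalCategory.tensorIso (Iso.refl _) p ≪≫ mulIso c a) (mulIso c b)
        (tensorWord c ◁ φ) := by
  rw [(id c).eq_conj]
  refine (conj_mul_conj _ _ _ _ _ _).trans ?_
  simp [conj, id]

theorem conj_hom (p : P ≅ tensorWord a) : conj p (Iso.refl _) p.hom = id a := by
  simp [conj, id]

/-- The empty word spells the unit object. -/
def oneIso (h : c = 1) : tensorWord c ≅ 𝟙_ B := eqToIso (congrArg tensorWord h)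

theorem conj_leftUnitor (h : c = 1) (a : FreeMonoid B) :
    conj (mulIso c a) (Iso.refl _)
      ((oneIso h).hom ▷ tensorWord a ≫ (λ_ (tensorWord a)).hom) = id a := by
  subst h
  have h : 𝟙 (𝟙_ B) ▷ tensorWord a ≫ (λ_ (tensorWord a)).hom = (λ_ (tensorWord a)).hom := by simp
  exact (congrArg (conj (λ_ (tensorWord a)) (Iso.refl _)) h).trans (conj_hom _)

theorem conj_rightUnitor (h : c = 1) (a : FreeMonoid B) :
    conj (mulIso a c) (Iso.refl _)
      (tensorWord a ◁ (oneIso h).hom ≫ (ρ_ (tensorWord a)).hom) = id a := by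
  subst h
  have h : tensorWord a ◁ 𝟙 (𝟙_ B) ≫ (ρ_ (tensorWord a)).hom = (ρ_ (tensorWord a)).hom := by simp
  exact (conj_eq_conj _ (mul_one a) (mulIso_one a) rfl (Category.comp_id _)).trans
    ((congrArg (conj (ρ_ (tensorWord a)) (Iso.refl _)) h).trans (conj_hom _))

end Coherence

section Braided

variable [BraidedCategory B]

/-- The braiding of the objects spelled by two words. -/
def swap (a b : FreeMonoid B) : WordHom B :=
  conj (mulIso a b) (mulIso b a) (β_ (tensorWord a) (tensorWord b)).hom

@[simp] theorem dom_swap (a b : FreeMonoid B) : (swap a b).dom = a * b := (rfl)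

@[simp] theorem cod_swap (a b : FreeMonoid B) : (swap a b).cod = b * a := (rfl)

instance (a b : FreeMonoid B) : IsIso (swap a b).hom :=
  isIso_hom_conj _ _ (β_ _ _).hom

theorem mul_comp_swap (φ ψ : WordHom B) :
    (φ * ψ) ⊚ swap φ.cod ψ.cod = swap φ.dom ψ.dom ⊚ (ψ * φ) :=
  (conj_comp_conj _ _ _ _ _).trans
    ((congrArg (conj _ _) (BraidedCategory.braiding_naturality φ.hom ψ.hom)).trans
      (conj_comp_conj _ _ _ _ _).symm)

theorem swap_mul_id (a b c : FreeMonoid B) : swap a b * id c =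
    conj (mulIso₃ a b c) (mulIso₃ b a c)
      ((β_ (tensorWord a) (tensorWord b)).hom ▷ tensorWord c) := by
  rw [← MonoidalCategory.tensorHom_id]
  nth_rewrite 1 [(id c).eq_conj]
  exact conj_mul_conj _ _ _ _ _ _

theorem id_mul_swap (a b c : FreeMonoid B) : id a * swap b c =
    conj (mulIso₃' a b c) (mulIso₃' a c b)
      (tensorWord a ◁ (β_ (tensorWord b) (tensorWord c)).hom) := by
  rw [← MonoidalCategory.id_tensorHom]
  nth_rewrite 1 [(id a).eq_conj]
  exact conj_mul_conj _ _ _ _ _ _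

theorem swap_mul (a b c : FreeMonoid B) :
    swap a (b * c) = (swap a b * id c) ⊚ (id b * swap a c) := by
  have h : swap a (b * c) = conj (mulIso₃' a b c) (mulIso₃ b c a)
      (β_ (tensorWord a) (tensorWord b ⊗ tensorWord c)).hom := by
    rw [conj_trans]
    simp [swap, -BraidedCategory.braiding_tensor_right_hom,
      -BraidedCategory.braiding_tensor_left_hom]
  rw [h, swap_mul_id, id_mul_swap, conj_mulIso₃_right, conj_mulIso₃_left, conj_mulIso₃_right,
    conj_comp_conj]
  congr 1
  simp

theorem mul_swap (a b c : FreeMonoid B) :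
    swap (a * b) c = (id a * swap b c) ⊚ (swap a c * id b) := by
  have h : swap (a * b) c = conj (mulIso₃ a b c) (mulIso₃' c a b)
      (β_ (tensorWord a ⊗ tensorWord b) (tensorWord c)).hom := by
    rw [conj_trans]
    simp [swap, -BraidedCategory.braiding_tensor_right_hom,
      -BraidedCategory.braiding_tensor_left_hom]
  rw [h, swap_mul_id, id_mul_swap, conj_mulIso₃_left, conj_mulIso₃_left, conj_mulIso₃_right,
    conj_comp_conj]
  congr 1
  simp

theorem swap_one (a : FreeMonoid B) : swap a 1 = id a := by
  have h : swap a 1 = conj (ρ_ (tensorWord a) ≪≫ Iso.refl _) (λ_ (tensorWord a) ≪≫ Iso.refl _)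
      (β_ (tensorWord a) (𝟙_ B)).hom :=
    conj_eq_conj _ (mul_one a) (by simpa using mulIso_one a) (one_mul a)
      ((Category.comp_id _).trans (Category.comp_id _).symm)
  rw [h, conj_trans]
  simp [conj, id]

theorem one_swap (a : FreeMonoid B) : swap 1 a = id a := by
  have h : swap 1 a = conj (λ_ (tensorWord a) ≪≫ Iso.refl _) (ρ_ (tensorWord a) ≪≫ Iso.refl _)
      (β_ (𝟙_ B) (tensorWord a)).hom :=
    conj_eq_conj _ (one_mul a) ((Category.comp_id _).trans (Category.comp_id _).symm) (mul_one a)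
      (by simpa using mulIso_one a)
  rw [h, conj_trans]
  simp [conj, id]

/-- The isomorphism that moves the third of four words past the second. -/
def midSwap (x y a b : FreeMonoid B) : WordHom B := id x * swap y a * id b

@[simp] theorem dom_midSwap (x y a b : FreeMonoid B) : (midSwap x y a b).dom = x * y * a * b := by
  simp [midSwap, mul_assoc]

@[simp] theorem cod_midSwap (x y a b : FreeMonoid B) : (midSwap x y a b).cod = x * a * y * b := by
  simp [midSwap, mul_assoc]

instance (x y a b : FreeMonoid B) : IsIso (midSwap x y a b).hom :=
  inferInstanceAs (IsIso (id x * swap y a * id b).hom)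

theorem midSwap_one_left (x a b : FreeMonoid B) : midSwap x 1 a b = id (x * a * b) := by
  rw [midSwap, one_swap, id_mul, id_mul]

theorem midSwap_one_right (x y b : FreeMonoid B) : midSwap x y 1 b = id (x * y * b) := by
  rw [midSwap, swap_one, id_mul, id_mul]

theorem mul_comp_midSwap (φ ψ χ ω : WordHom B) :
    (φ * ψ * χ * ω) ⊚ midSwap φ.cod ψ.cod χ.cod ω.cod =
      midSwap φ.dom ψ.dom χ.dom ω.dom ⊚ (φ * χ * ψ * ω) := by
  rw [midSwap, midSwap, mul_assoc φ ψ, mul_assoc φ χ, mul_comp_mul (by simp) rfl,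
    mul_comp_mul rfl rfl, mul_comp_swap, mul_comp_mul (by simp) rfl, mul_comp_mul rfl rfl]
  simp only [id_comp, comp_id]

theorem midSwap_mul_midSwap (x y a b a' b' : FreeMonoid B) :
    (midSwap x y a b * id (a' * b')) ⊚ midSwap (x * a) (y * b) a' b' =
      (id (x * y) * midSwap a b a' b') ⊚ midSwap x y (a * a') (b * b') := by
  have core : (swap y a * id (b * a')) ⊚ (id a * swap (y * b) a') =
      (id (y * a) * swap b a') ⊚ (swap y (a * a') * id b) := by
    rw [mul_swap, swap_mul, id_mul_comp _ (by simp [mul_assoc]),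
      comp_mul_id _ (by simp [mul_assoc]),
      ← comp_assoc (by simp [mul_assoc]) (by simp [mul_assoc]),
      ← comp_assoc (by simp [mul_assoc]) (by simp [mul_assoc])]
    have slide := (mul_eq_left_comp_right (swap y a) (swap b a')).symm.trans
      (mul_eq_right_comp_left _ _)
    simp only [dom_swap, cod_swap, id_mul, mul_assoc] at slide ⊢
    rw [slide]
  have widen := congrArg (fun φ => id x * φ * id b') core
  simp only [id_mul_comp, comp_mul_id, dom_mul, cod_mul, dom_id, cod_id, dom_swap, cod_swap,
    mul_assoc] at widen
  simpa only [midSwap, id_mul, mul_assoc] using widen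

theorem midSwap_comp_midSwap_mul (x y z a b c : FreeMonoid B) :
    midSwap (x * y) z (a * b) c ⊚ (midSwap x y a b * id (z * c)) =
      midSwap x (y * z) a (b * c) ⊚ (id (x * a) * midSwap y z b c) := by
  have core : (id y * swap z (a * b)) ⊚ (swap y a * id (b * z)) =
      (swap (y * z) a * id b) ⊚ (id (a * y) * swap z b) := by
    rw [mul_swap, swap_mul, id_mul_comp _ (by simp [mul_assoc]),
      comp_mul_id _ (by simp [mul_assoc]),
      comp_assoc (by simp [mul_assoc]) (by simp [mul_assoc]),
      comp_assoc (by simp [mul_assoc]) (by simp [mul_assoc])]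
    have slide := (mul_eq_left_comp_right (swap y a) (swap z b)).symm.trans
      (mul_eq_right_comp_left _ _)
    simp only [dom_swap, cod_swap, id_mul, mul_assoc] at slide ⊢
    rw [slide]
  have widen := congrArg (fun φ => id x * φ * id c) core
  simp only [id_mul_comp, comp_mul_id, dom_mul, cod_mul, dom_id, cod_id, dom_swap, cod_swap,
    mul_assoc] at widen
  simpa only [midSwap, id_mul, mul_assoc] using widen

end Braided

end WordHom

end Words

/-! ### The 2-category of strands -/

/-- The objects of the 2-category constructed from `B`: an object stands for `extra + 1` parallel
strands. There is no object without strands. The universe `v` is that of the morphisms of `B`. -/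
structure Strands (B : Type u) : Type (max u v) where
  /-- the number of strands beyond the first -/
  extra : ℕ

namespace Strands

variable {B : Type u}

/-- A labelling of the strands of `X` by words. -/
def Labelling (X : Strands.{v} B) : Type u :=
  { x : List (FreeMonoid B) // x.length = X.extra + 1 }

/-- The unit object, a single strand. -/
def unit : Strands.{v} B := ⟨0⟩

/-- Juxtaposition of strands. -/
def tensor (X Y : Strands.{v} B) : Strands.{v} B := ⟨X.extra + Y.extra + 1⟩

theorem tensor_assoc (X Y Z : Strands.{v} B) :
    tensor (tensor X Y) Z = tensor X (tensor Y Z) :=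
  congrArg mk (by simp only [tensor]; omega)

namespace Labelling

variable {X Y : Strands.{v} B}

/-- The product of the labels. -/
def word (x : X.Labelling) : FreeMonoid B := x.1.prod

/-- The labelling of all strands by the empty word. -/
def blank (X : Strands.{v} B) : X.Labelling := ⟨List.replicate (X.extra + 1) 1, by simp⟩

/-- The labelling of the first strand by `a` and of the others by the empty word. -/
def first (X : Strands.{v} B) (a : FreeMonoid B) : X.Labelling :=
  ⟨a :: List.replicate X.extra 1, by simp⟩

@[simp] theorem word_blank : (blank X).word = 1 := by simp [word, blank]

@[simp] theorem word_first (a : FreeMonoid B) : (first X a).word = a := by simp [word, first]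

/-- Juxtaposition of labellings. -/
def pair (x : X.Labelling) (y : Y.Labelling) : (tensor X Y).Labelling :=
  ⟨x.1 ++ y.1, by simp only [List.length_append, x.2, y.2, tensor]; omega⟩

/-- The labels of the strands of `X`. -/
def fst (z : (tensor X Y).Labelling) : X.Labelling :=
  ⟨z.1.take (X.extra + 1), by simp only [List.length_take, z.2, tensor]; omega⟩

/-- The labels of the strands of `Y`. -/
def snd (z : (tensor X Y).Labelling) : Y.Labelling :=
  ⟨z.1.drop (X.extra + 1), by simp only [List.length_drop, z.2, tensor]; omega⟩

@[simp] theorem fst_pair (x : X.Labelling) (y : Y.Labelling) : (pair x y).fst = x :=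
  Subtype.ext (List.take_left' x.2)

@[simp] theorem snd_pair (x : X.Labelling) (y : Y.Labelling) : (pair x y).snd = y :=
  Subtype.ext (List.drop_left' x.2)

@[simp] theorem pair_fst_snd (z : (tensor X Y).Labelling) : pair z.fst z.snd = z :=
  Subtype.ext (List.take_append_drop _ _)

theorem exists_pair (z : (tensor X Y).Labelling) : ∃ x y, z = pair x y :=
  ⟨z.fst, z.snd, (pair_fst_snd z).symm⟩

@[simp] theorem word_pair (x : X.Labelling) (y : Y.Labelling) :
    (pair x y).word = x.word * y.word :=
  List.prod_append

theorem pair_blank_blank : pair (blank X) (blank Y) = blank (tensor X Y) :=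
  Subtype.ext (by simp only [pair, blank, tensor, List.replicate_append_replicate]; congr 1; omega)

@[simp] theorem fst_blank : (blank (tensor X Y)).fst = blank X := by
  rw [← pair_blank_blank, fst_pair]

@[simp] theorem snd_blank : (blank (tensor X Y)).snd = blank Y := by
  rw [← pair_blank_blank, snd_pair]

end Labelling

end Strands

open Strands Labelling in
/-- A right linear map from labellings of `X` to labellings of `Y`: multiplying the word of a
labelling by the weight of the map gives the word of its image, up to the isomorphism `lin`. -/
structure StrandMap {B : Type u} [Category.{v} B] [MonoidalCategory B] (X Y : Strands.{v} B) where
  /-- the map of labellings -/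
  toFun : X.Labelling → Y.Labelling
  /-- the isomorphism that compares the two words -/
  lin : X.Labelling → WordHom B
  dom_lin (x : X.Labelling) : (lin x).dom = x.word * (toFun (blank X)).word
  cod_lin (x : X.Labelling) : (lin x).cod = (toFun x).word
  isIso_lin (x : X.Labelling) : IsIso (lin x).hom
  lin_blank : lin (blank X) = .id (toFun (blank X)).word

namespace StrandMap

open Strands Labelling WordHom

variable {B : Type u} [Category.{v} B] [MonoidalCategory B]
  {X Y Z V X' Y' Z' X'' Y'' : Strands.{v} B}

instance : CoeFun (StrandMap X Y) fun _ => X.Labelling → Y.Labelling := ⟨toFun⟩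

attribute [simp] cod_lin lin_blank

attribute [instance] isIso_lin

/-- The word that `f` makes of a blank labelling. -/
def weight (f : StrandMap X Y) : FreeMonoid B := (f (blank X)).word

@[simp] theorem dom_lin' (f : StrandMap X Y) (x : X.Labelling) :
    (f.lin x).dom = x.word * f.weight :=
  f.dom_lin x

theorem ext {f g : StrandMap X Y} (h : ∀ x, f x = g x) (h' : ∀ x, f.lin x = g.lin x) : f = g := by
  obtain ⟨f, l, _, _, _, _⟩ := f
  obtain ⟨g, l', _, _, _, _⟩ := g
  obtain rfl : f = g := funext h
  obtain rfl : l = l' := funext h'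
  rfl

theorem heq_of_forall {f : StrandMap X Y} {f' : StrandMap X' Y'}
    (hX : X = X') (hY : Y = Y')
    (h : ∀ x x', x.1 = x'.1 → (f x).1 = (f' x').1 ∧ f.lin x = f'.lin x') : f ≍ f' := by
  subst hX hY
  exact heq_of_eq (ext (fun x => Subtype.ext (h x x rfl).1) fun x => (h x x rfl).2)

/-- The weight of a composite is the product of the weights, up to this isomorphism. -/
def mu (f : StrandMap X Y) (g : StrandMap Y Z) : WordHom B := g.lin (f (blank X))

instance (f : StrandMap X Y) (g : StrandMap Y Z) : IsIso (mu f g).hom := g.isIso_lin _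

/-- The identity map of labellings. -/
def id (X : Strands.{v} B) : StrandMap X X where
  toFun x := x
  lin x := .id x.word
  dom_lin x := by simp
  cod_lin x := rfl
  isIso_lin x := inferInstance
  lin_blank := rfl

/-- The composite of right linear maps. -/
noncomputable def comp (f : StrandMap X Y) (g : StrandMap Y Z) : StrandMap X Z where
  toFun x := g (f x)
  lin x := inv (.id x.word * mu f g) ⊚ (f.lin x * .id g.weight) ⊚ g.lin (f x)
  dom_lin x := by simp [mu]
  cod_lin x := by simp [cod_comp, mu, weight, mul_assoc]
  isIso_lin x := inferInstance
  lin_blank := by simp [mu, id_one, ← id_mul, id_comp, inv_comp, weight]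

section Composition

variable (f : StrandMap X Y) (g : StrandMap Y Z) (h : StrandMap Z V)

@[simp] theorem comp_apply (x : X.Labelling) : comp f g x = g (f x) := rfl

@[simp] theorem dom_mu : (mu f g).dom = f.weight * g.weight := by simp [mu, weight]

@[simp] theorem cod_mu : (mu f g).cod = (comp f g).weight := by simp [mu, weight, comp]

theorem mul_mu_comp_lin (x : X.Labelling) :
    (.id x.word * mu f g) ⊚ (comp f g).lin x = (f.lin x * .id g.weight) ⊚ g.lin (f x) :=
  comp_inv_comp (by simp [mul_assoc])

theorem mu_assoc :
    (mu f g * .id h.weight) ⊚ mu (comp f g) h = (.id f.weight * mu g h) ⊚ mu f (comp g h) :=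
  (mul_mu_comp_lin g h (f (blank X))).symm

theorem comp_assoc : comp (comp f g) h = comp f (comp g h) := by
  refine ext (fun x => rfl) fun x => ?_
  have left : (.id x.word * ((mu f g * .id h.weight) ⊚ mu (comp f g) h)) ⊚
      (comp (comp f g) h).lin x =
        (f.lin x * .id g.weight * .id h.weight) ⊚ (g.lin (f x) * .id h.weight) ⊚
          h.lin (g (f x)) := by
    rw [id_mul_comp _ (by simp), WordHom.comp_assoc (by simp) (by simp),
      mul_mu_comp_lin, ← WordHom.comp_assoc (by simp [mul_assoc]) (by simp), ← mul_assoc,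
      ← comp_mul_id _ (by simp), mul_mu_comp_lin, comp_mul_id _ (by simp),
      WordHom.comp_assoc (by simp) (by simp)]
    rfl
  have right : (.id x.word * ((.id f.weight * mu g h) ⊚ mu f (comp g h))) ⊚
      (comp f (comp g h)).lin x =
        (f.lin x * .id (g.weight * h.weight)) ⊚ (g.lin (f x) * .id h.weight) ⊚
          h.lin (g (f x)) := by
    have slide : (.id x.word * (.id f.weight * mu g h)) ⊚ (f.lin x * .id (comp g h).weight) =
        (f.lin x * .id (g.weight * h.weight)) ⊚ (.id (f x).word * mu g h) := by
      have := (mul_eq_right_comp_left (f.lin x) (mu g h)).symm.trans (mul_eq_left_comp_right _ _)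
      simpa [id_mul, mul_assoc] using this
    rw [id_mul_comp _ (by simp), WordHom.comp_assoc (by simp) (by simp),
      mul_mu_comp_lin, ← WordHom.comp_assoc (by simp [mul_assoc]) (by simp), slide,
      WordHom.comp_assoc (by simp) (by simp), mul_mu_comp_lin]
  rw [mul_assoc, ← id_mul, ← right, mu_assoc] at left
  exact comp_left_cancel _ (by simp [cod_comp]; rfl)
    (by simp [cod_comp]) left

end Composition

theorem weight_id (X : Strands.{v} B) : weight (id X) = 1 := word_blank

theorem mu_id_left (f : StrandMap X Y) : mu (id X) f = .id f.weight := f.lin_blank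

theorem mu_id_right (f : StrandMap X Y) : mu f (id Y) = .id f.weight := rfl

theorem id_comp (f : StrandMap X Y) : comp (id X) f = f := by
  refine ext (fun x => rfl) fun x => ?_
  have h := mul_mu_comp_lin (id X) f x
  rw [mu_id_left, id, ← id_mul, WordHom.id_comp (f.dom_lin' x)] at h
  rwa [WordHom.id_comp (by simp [weight])] at h

theorem comp_id (f : StrandMap X Y) : comp f (id Y) = f := by
  refine ext (fun x => rfl) fun x => ?_
  have h := mul_mu_comp_lin f (id Y) x
  rw [mu_id_right, weight_id, id_one, mul_one, id, ← id_mul,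
    WordHom.comp_id (f.cod_lin x)] at h
  rwa [WordHom.id_comp (by simp [weight])] at h

/-- A map that changes neither words nor blank labellings. -/
structure IsPlain (p : StrandMap X Y) : Prop where
  word_apply (x : X.Labelling) : (p x).word = x.word
  apply_blank : p (blank X) = blank Y
  lin_eq (x : X.Labelling) : p.lin x = .id x.word

/-- The map that moves all labels to the first strand. -/
def gather (X Y : Strands.{v} B) : StrandMap X Y where
  toFun x := first Y x.word
  lin x := .id x.word
  dom_lin x := by simp
  cod_lin x := by simp
  isIso_lin x := inferInstance
  lin_blank := by simp

theorem isPlain_id (X : Strands.{v} B) : IsPlain (id X) := ⟨fun _ => rfl, rfl, fun _ => rfl⟩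

theorem isPlain_gather (X Y : Strands.{v} B) : IsPlain (gather X Y) :=
  ⟨fun _ => word_first _, congrArg (first Y) word_blank, fun _ => rfl⟩

namespace IsPlain

variable {p : StrandMap X Y}

theorem weight_eq_one (hp : IsPlain p) : p.weight = 1 := (hp.word_apply _).trans word_blank

theorem mu_right (hp : IsPlain p) (f : StrandMap Z X) : mu f p = .id f.weight := hp.lin_eq _

theorem mu_left (hp : IsPlain p) (g : StrandMap Y Z) : mu p g = .id g.weight := by
  rw [mu, hp.apply_blank, lin_blank]; rfl

theorem weight_comp_right (hp : IsPlain p) (f : StrandMap Z X) :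
    (comp f p).weight = f.weight :=
  hp.word_apply _

theorem weight_comp_left (hp : IsPlain p) (g : StrandMap Y Z) : (comp p g).weight = g.weight :=
  congrArg (fun y => (g y).word) hp.apply_blank

end IsPlain

instance instCategory : Category.{v} (StrandMap X Y) :=
  inferInstanceAs (Category (InducedCategory B fun f : StrandMap X Y => tensorWord f.weight))

/-- The morphism of words that a 2-cell consists of. It does not mention the boundary, so that it
can be compared between 2-cells with different boundaries. -/
def mor {f g : StrandMap X Y} (η : f ⟶ g) : WordHom B := ⟨f.weight, g.weight, η.hom⟩

@[simp] theorem dom_mor {f g : StrandMap X Y} (η : f ⟶ g) : (mor η).dom = f.weight := (rfl)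

@[simp] theorem cod_mor {f g : StrandMap X Y} (η : f ⟶ g) : (mor η).cod = g.weight := (rfl)

theorem mor_injective {f g : StrandMap X Y} {η θ : f ⟶ g} (h : mor η = mor θ) : η = θ :=
  InducedCategory.hom_ext (eq_of_heq (WordHom.mk.inj h).2.2)

@[simp] theorem mor_id (f : StrandMap X Y) : mor (𝟙 f) = .id f.weight := rfl

@[simp] theorem mor_comp {f g h : StrandMap X Y} (η : f ⟶ g) (θ : g ⟶ h) :
    mor (η ≫ θ) = mor η ⊚ mor θ :=
  (comp_mk _ _).symm

@[simp] theorem mor_eqToHom {f g : StrandMap X Y} (h : f = g) :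
    mor (eqToHom h) = .id f.weight := by
  subst h; rfl

theorem mor_eqToHom_comp {f g h : StrandMap X Y} (e : f = g) (η : g ⟶ h) :
    mor (eqToHom e ≫ η) = mor η := by
  subst e; rw [eqToHom_refl, Category.id_comp]

theorem mor_comp_eqToHom {f g h : StrandMap X Y} (η : f ⟶ g) (e : g = h) :
    mor (η ≫ eqToHom e) = mor η := by
  subst e; rw [eqToHom_refl, Category.comp_id]

/-- The 2-cell that consists of `φ`. -/
def ofMor {f g : StrandMap X Y} (φ : WordHom B) (hd : φ.dom = f.weight) (hc : φ.cod = g.weight) :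
    f ⟶ g :=
  InducedCategory.homMk
    (eqToHom (congrArg tensorWord hd.symm) ≫ φ.hom ≫ eqToHom (congrArg tensorWord hc))

@[simp] theorem mor_ofMor {f g : StrandMap X Y} (φ : WordHom B) (hd : φ.dom = f.weight)
    (hc : φ.cod = g.weight) : mor (ofMor φ hd hc) = φ := by
  obtain ⟨a, b, φ⟩ := φ
  dsimp only at hd hc
  subst hd hc
  simp [mor, ofMor]

/-- The invertible 2-cell between two maps of the same weight. -/
def castIso {f g : StrandMap X Y} (h : f.weight = g.weight) : f ≅ g where
  hom := ofMor (.id f.weight) (dom_id _) ((cod_id _).trans h)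
  inv := ofMor (.id f.weight) ((dom_id _).trans h) (cod_id _)
  hom_inv_id := mor_injective <| by
    rw [mor_comp, mor_ofMor, mor_ofMor, WordHom.id_comp (dom_id _), mor_id]
  inv_hom_id := mor_injective <| by
    rw [mor_comp, mor_ofMor, mor_ofMor, WordHom.id_comp (dom_id _), mor_id, h]

/-- Horizontal composition of 2-cells. -/
noncomputable def hcomp {f f' : StrandMap X Y} {g g' : StrandMap Y Z} (η : f ⟶ f') (θ : g ⟶ g') :
    comp f g ⟶ comp f' g' :=
  ofMor (inv (mu f g) ⊚ (mor η * mor θ) ⊚ mu f' g') (by simp) (by simp [cod_comp])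

theorem mu_comp_mor_hcomp {f f' : StrandMap X Y} {g g' : StrandMap Y Z} (η : f ⟶ f') (θ : g ⟶ g') :
    mu f g ⊚ mor (hcomp η θ) = (mor η * mor θ) ⊚ mu f' g' := by
  rw [hcomp, mor_ofMor, comp_inv_comp (by simp)]

theorem hcomp_id_id (f : StrandMap X Y) (g : StrandMap Y Z) : hcomp (𝟙 f) (𝟙 g) = 𝟙 _ := by
  apply mor_injective
  apply comp_left_cancel (mu f g) (by simp) (by simp)
  rw [mu_comp_mor_hcomp, mor_id, mor_id, mor_id, ← id_mul, WordHom.id_comp (by simp),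
    WordHom.comp_id (by simp)]

theorem hcomp_eqToHom_id {f f' : StrandMap X Y} (e : f = f') (g : StrandMap Y Z) :
    hcomp (eqToHom e) (𝟙 g) = eqToHom (by rw [e]) := by
  subst e; exact hcomp_id_id f g

theorem hcomp_id_eqToHom (f : StrandMap X Y) {g g' : StrandMap Y Z} (e : g = g') :
    hcomp (𝟙 f) (eqToHom e) = eqToHom (by rw [e]) := by
  subst e; exact hcomp_id_id f g

theorem hcomp_comp_hcomp {f f' f'' : StrandMap X Y} {g g' g'' : StrandMap Y Z} (η : f ⟶ f')
    (η' : f' ⟶ f'') (θ : g ⟶ g') (θ' : g' ⟶ g'') :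
    hcomp η θ ≫ hcomp η' θ' = hcomp (η ≫ η') (θ ≫ θ') := by
  apply mor_injective
  apply comp_left_cancel (mu f g) (by simp) (by simp)
  rw [mor_comp, ← WordHom.comp_assoc (by simp) rfl, mu_comp_mor_hcomp,
    WordHom.comp_assoc (by simp) (by simp), mu_comp_mor_hcomp, mu_comp_mor_hcomp, mor_comp,
    mor_comp, ← WordHom.comp_assoc (by simp) (by simp), mul_comp_mul rfl rfl]

theorem mor_hcomp_id_left {f g : StrandMap X Y} (η : f ⟶ g) :
    mor (hcomp (𝟙 (id X)) η) = mor η := by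
  have h := mu_comp_mor_hcomp (𝟙 (id X)) η
  rwa [mu_id_left, mu_id_left, mor_id, weight_id, id_one, one_mul,
    WordHom.id_comp (by simp [id_comp]), WordHom.comp_id (cod_mor η)] at h

theorem mor_hcomp_id_right {f g : StrandMap X Y} (η : f ⟶ g) :
    mor (hcomp η (𝟙 (id Y))) = mor η := by
  have h := mu_comp_mor_hcomp η (𝟙 (id Y))
  rwa [mu_id_right, mu_id_right, mor_id, weight_id, id_one, mul_one,
    WordHom.id_comp (by simp [comp_id]), WordHom.comp_id (cod_mor η)] at h

theorem mor_hcomp_assoc {f f' : StrandMap X Y} {g g' : StrandMap Y Z} {h h' : StrandMap Z V}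
    (η : f ⟶ f') (θ : g ⟶ g') (ζ : h ⟶ h') :
    mor (hcomp (hcomp η θ) ζ) = mor (hcomp η (hcomp θ ζ)) := by
  have left : (mu f g * .id h.weight) ⊚ mu (comp f g) h ⊚ mor (hcomp (hcomp η θ) ζ) =
      (mor η * mor θ * mor ζ) ⊚ (mu f' g' * .id h'.weight) ⊚ mu (comp f' g') h' := by
    rw [mu_comp_mor_hcomp, ← WordHom.comp_assoc (by simp) (by simp), mul_comp_mul (by simp) rfl,
      mu_comp_mor_hcomp, WordHom.id_comp (dom_mor ζ),
      ← WordHom.comp_assoc (φ := mor η * mor θ * mor ζ) (by simp) (by simp),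
      mul_comp_mul (by simp) rfl, WordHom.comp_id (cod_mor ζ)]
  have right : (.id f.weight * mu g h) ⊚ mu f (comp g h) ⊚ mor (hcomp η (hcomp θ ζ)) =
      (mor η * (mor θ * mor ζ)) ⊚ (.id f'.weight * mu g' h') ⊚ mu f' (comp g' h') := by
    rw [mu_comp_mor_hcomp, ← WordHom.comp_assoc (by simp) (by simp), mul_comp_mul rfl (by simp),
      mu_comp_mor_hcomp, WordHom.id_comp (dom_mor η),
      ← WordHom.comp_assoc (φ := mor η * (mor θ * mor ζ)) (by simp) (by simp),
      mul_comp_mul rfl (by simp), WordHom.comp_id (cod_mor η)]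
  rw [mu_assoc f' g' h', mul_assoc (mor η), ← right, ← WordHom.comp_assoc (by simp) (by simp),
    ← WordHom.comp_assoc (by simp) (by simp), mu_assoc f g h] at left
  exact comp_left_cancel _ (by simp [cod_comp, comp_assoc]) (by simp [cod_comp]) left

noncomputable instance : CategoryTheory.Bicategory.{v, max u v} (Strands.{v} B) where
  Hom := StrandMap
  homCategory _ _ := instCategory
  id := StrandMap.id
  comp := StrandMap.comp
  whiskerLeft f _ _ η := hcomp (𝟙 f) η
  whiskerRight η h := hcomp η (𝟙 h)
  associator f g h := eqToIso (comp_assoc f g h)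
  leftUnitor f := eqToIso (StrandMap.id_comp f)
  rightUnitor f := eqToIso (StrandMap.comp_id f)
  whiskerLeft_id f g := hcomp_id_id f g
  whiskerLeft_comp f _ _ _ η θ := by rw [hcomp_comp_hcomp, Category.id_comp]
  id_whiskerLeft η := by
    apply mor_injective
    simp only [eqToIso.hom, eqToIso.inv, mor_eqToHom_comp, mor_comp_eqToHom, mor_hcomp_id_left]
  comp_whiskerLeft f g _ _ η := by
    apply mor_injective
    simp only [eqToIso.hom, eqToIso.inv, mor_eqToHom_comp, mor_comp_eqToHom, ← mor_hcomp_assoc,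
      hcomp_id_id]
  id_whiskerRight f g := hcomp_id_id f g
  comp_whiskerRight η θ h := by rw [hcomp_comp_hcomp, Category.id_comp]
  whiskerRight_id η := by
    apply mor_injective
    simp only [eqToIso.hom, eqToIso.inv, mor_eqToHom_comp, mor_comp_eqToHom, mor_hcomp_id_right]
  whiskerRight_comp η g h := by
    apply mor_injective
    simp only [eqToIso.hom, eqToIso.inv, mor_eqToHom_comp, mor_comp_eqToHom, mor_hcomp_assoc,
      hcomp_id_id]
  whisker_assoc f _ _ η h := by
    apply mor_injective
    simp only [eqToIso.hom, eqToIso.inv, mor_eqToHom_comp, mor_comp_eqToHom, mor_hcomp_assoc]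
  whisker_exchange η θ := by
    simp only [hcomp_comp_hcomp, Category.id_comp, Category.comp_id]
  pentagon f g h i := by
    simp only [eqToIso.hom, hcomp_eqToHom_id, hcomp_id_eqToHom, eqToHom_trans]
  triangle f g := by
    simp only [eqToIso.hom, hcomp_eqToHom_id, hcomp_id_eqToHom, eqToHom_trans]

instance : CategoryTheory.Bicategory.Strict (Strands.{v} B) where
  id_comp := StrandMap.id_comp
  comp_id := StrandMap.comp_id
  assoc := comp_assoc
  leftUnitor_eqToIso _ := rfl
  rightUnitor_eqToIso _ := rfl
  associator_eqToIso _ _ _ := rfl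

theorem heq_of_mor_eq (hX : X = X') (hY : Y = Y')
    {f g : StrandMap X Y} {f' g' : StrandMap X' Y'} (hf : f ≍ f') (hg : g ≍ g') {η : f ⟶ g}
    {η' : f' ⟶ g'} (h : mor η = mor η') : η ≍ η' := by
  subst hX hY
  subst hf hg
  exact heq_of_eq (mor_injective h)

theorem IsPlain.comp {p : X ⟶ Y} {q : Y ⟶ Z} (hp : IsPlain p) (hq : IsPlain q) :
    IsPlain (p ≫ q) where
  word_apply x := (hq.word_apply _).trans (hp.word_apply x)
  apply_blank := (congrArg (toFun q) hp.apply_blank).trans hq.apply_blank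
  lin_eq x := by
    have h := mul_mu_comp_lin p q x
    rw [hq.mu_right, hp.lin_eq, hq.lin_eq, ← id_mul, ← id_mul, hp.weight_eq_one, hq.weight_eq_one,
      mul_one, hp.word_apply, WordHom.id_comp (dom_id _), WordHom.id_comp] at h
    · exact h
    · exact (dom_lin' _ x).trans (by rw [hq.weight_comp_right, hp.weight_eq_one, mul_one])

theorem isPlain_eqToHom (e : X = Y) : IsPlain (eqToHom e : X ⟶ Y) := by
  subst e
  exact isPlain_id X

/-- A 2-cell that consists of an identity of words. -/
def IsInert {f g : StrandMap X Y} (η : f ⟶ g) : Prop := mor η = .id f.weight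

section

variable {f g h : X ⟶ Y}

theorem isInert_id (f : X ⟶ Y) : IsInert (𝟙 f) := mor_id f

theorem isInert_eqToHom (e : f = g) : IsInert (eqToHom e) := mor_eqToHom e

theorem isInert_castIso (e : weight f = weight g) : IsInert (castIso e).hom := by
  rw [IsInert, castIso, mor_ofMor]

theorem IsInert.weight_eq {η : f ⟶ g} (hη : IsInert η) : weight f = weight g :=
  (congrArg cod hη).symm

theorem IsInert.mor_comp_left {η : f ⟶ g} (hη : IsInert η) (θ : g ⟶ h) :
    mor (η ≫ θ) = mor θ := by
  rw [mor_comp, hη, WordHom.id_comp ((dom_mor θ).trans hη.weight_eq.symm)]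

theorem IsInert.mor_comp_right {θ : g ⟶ h} (hθ : IsInert θ) (η : f ⟶ g) :
    mor (η ≫ θ) = mor η := by
  rw [mor_comp, hθ, WordHom.comp_id (cod_mor η)]

theorem IsInert.comp {η : f ⟶ g} {θ : g ⟶ h} (hη : IsInert η) (hθ : IsInert θ) :
    IsInert (η ≫ θ) :=
  (hθ.mor_comp_right η).trans hη

theorem IsInert.inv {η : f ≅ g} (hη : IsInert η.hom) : IsInert η.inv := by
  rw [IsInert, ← hη.mor_comp_left, η.hom_inv_id, mor_id, hη.weight_eq]

theorem IsInert.eq {η θ : f ⟶ g} (hη : IsInert η) (hθ : IsInert θ) : η = θ :=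
  mor_injective (hη.trans hθ.symm)

theorem IsPlain.mor_whiskerRight {p : Y ⟶ Z} (hp : IsPlain p) (η : f ⟶ g) :
    mor (η ▷ p) = mor η := by
  have h := mu_comp_mor_hcomp η (𝟙 p)
  rwa [hp.mu_right, hp.mu_right, mor_id, hp.weight_eq_one, id_one, mul_one,
    WordHom.comp_id (cod_mor η), WordHom.id_comp] at h
  exact (dom_mor _).trans (hp.weight_comp_right f)

theorem IsPlain.mor_whiskerLeft {p : Z ⟶ X} (hp : IsPlain p) (η : f ⟶ g) :
    mor (p ◁ η) = mor η := by
  have h := mu_comp_mor_hcomp (𝟙 p) η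
  rwa [hp.mu_left, hp.mu_left, mor_id, hp.weight_eq_one, id_one, one_mul,
    WordHom.comp_id (cod_mor η), WordHom.id_comp] at h
  exact (dom_mor _).trans (hp.weight_comp_left f)

theorem IsInert.mu_comp_mor_whiskerLeft {η : f ⟶ g} (hη : IsInert η) (k : Z ⟶ X) :
    mu k f ⊚ mor (k ◁ η) = mu k g := by
  refine (mu_comp_mor_hcomp (𝟙 k) η).trans ?_
  rw [mor_id, hη, ← id_mul, WordHom.id_comp (by simp [hη.weight_eq])]

theorem IsInert.mu_comp_mor_whiskerRight {η : f ⟶ g} (hη : IsInert η) (k : Y ⟶ Z) :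
    mu f k ⊚ mor (η ▷ k) = mu g k := by
  refine (mu_comp_mor_hcomp η (𝟙 k)).trans ?_
  rw [mor_id, hη, ← id_mul, WordHom.id_comp (by simp [hη.weight_eq])]

theorem IsInert.whiskerRight {η : f ⟶ g} (hη : IsInert η) (hf : IsPlain f) (hg : IsPlain g)
    (k : Y ⟶ Z) : IsInert (η ▷ k) := by
  have h := hη.mu_comp_mor_whiskerRight k
  rw [hf.mu_left, hg.mu_left, WordHom.id_comp] at h
  · exact h.trans (congrArg WordHom.id (hf.weight_comp_left k).symm)
  · exact (dom_mor _).trans (hf.weight_comp_left k)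

theorem IsInert.whiskerLeft {η : f ⟶ g} (hη : IsInert η) (hf : IsPlain f) (hg : IsPlain g)
    (k : Z ⟶ X) : IsInert (k ◁ η) := by
  have h := hη.mu_comp_mor_whiskerLeft k
  rw [hf.mu_right, hg.mu_right, WordHom.id_comp] at h
  · exact h.trans (congrArg WordHom.id (hf.weight_comp_right k).symm)
  · exact (dom_mor _).trans (hf.weight_comp_right k)

end

theorem IsInert.twoCellComp {f g : X ⟶ Y} {f' g' : X' ⟶ Y'}
    {f'' g'' : X'' ⟶ Y''} {η : f ⟶ g} {θ : f' ⟶ g'} {ζ : f'' ⟶ g''} (hη : IsInert η)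
    (hθ : IsInert θ) (hζ : IsInert ζ) (hs : Arrow.mk f'' = Arrow.mk f)
    (h : Arrow.mk g = Arrow.mk f') (ht : Arrow.mk g' = Arrow.mk g'') :
    TwoCell.Comp ⟨η⟩ ⟨θ⟩ ⟨ζ⟩ := by
  cases hs
  cases h
  cases ht
  rw [hζ.eq (hη.comp hθ)]
  exact .mk η θ

theorem IsInert.twoCellSquare {X' Y' X₁ Y₁ X₁' Y₁' : Strands.{v} B} {f g : X ⟶ Y}
    {f' g' : X' ⟶ Y'} {f₁ g₁ : X₁ ⟶ Y₁} {f₁' g₁' : X₁' ⟶ Y₁'} {η : f ⟶ g} {θ : f' ⟶ g'}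
    {η₁ : f₁ ⟶ g₁} {θ₁ : f₁' ⟶ g₁'} (hη : IsInert η) (hθ : IsInert θ) (hη₁ : IsInert η₁)
    (hθ₁ : IsInert θ₁) (hs : Arrow.mk f₁ = Arrow.mk f) (h : Arrow.mk g = Arrow.mk f')
    (h₁ : Arrow.mk g₁ = Arrow.mk f₁') (ht : Arrow.mk g₁' = Arrow.mk g') :
    TwoCell.Square ⟨η⟩ ⟨θ⟩ ⟨η₁⟩ ⟨θ₁⟩ := by
  cases h
  exact ⟨⟨η ≫ θ⟩, .mk η θ, hη₁.twoCellComp hθ₁ (hη.comp hθ) hs.symm h₁ ht⟩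

theorem comp_mor_inv {f g : X ⟶ Y} (η : f ≅ g) {φ : WordHom B}
    (hφ : φ.cod = weight f) : (φ ⊚ mor η.hom) ⊚ mor η.inv = φ := by
  rw [WordHom.comp_assoc hφ (cod_mor _), ← mor_comp, η.hom_inv_id, mor_id, WordHom.comp_id hφ]

theorem IsPlain.mu_comp_right {p : Z ⟶ Z'} (hp : IsPlain p) (f : X ⟶ Y) (g : Y ⟶ Z) :
    mu f (g ≫ p) = mu f g := by
  have h := mu_assoc f g p
  rw [hp.mu_right, hp.mu_right, hp.weight_eq_one, id_one, mul_one, ← id_mul,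
    WordHom.comp_id (cod_mu f g), WordHom.id_comp] at h
  · exact h.symm
  · exact (dom_mu f _).trans (congrArg (weight f * ·) (hp.weight_comp_right g))

theorem IsPlain.mu_comp_middle {p : Y ⟶ Y'} (hp : IsPlain p) (f : X ⟶ Y) (g : Y' ⟶ Z) :
    mu (f ≫ p) g = mu f (p ≫ g) := by
  have h := mu_assoc f p g
  rw [hp.mu_right, hp.mu_left, ← id_mul, WordHom.id_comp, WordHom.id_comp] at h
  · exact h
  · exact (dom_mu f _).trans (congrArg (weight f * ·) (hp.weight_comp_left g))
  · exact (dom_mu _ g).trans (congrArg (· * weight g) (hp.weight_comp_right f))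

theorem IsPlain.mu_comp_left {p : X' ⟶ X} (hp : IsPlain p) (f : X ⟶ Y) (g : Y ⟶ Z) :
    mu (p ≫ f) g = mu f g := by
  have h := mu_assoc p f g
  rw [hp.mu_left, hp.mu_left, hp.weight_eq_one, id_one, one_mul, ← id_mul, WordHom.id_comp,
    WordHom.comp_id (cod_mu f g)] at h
  · exact h
  · exact (dom_mu _ g).trans (congrArg (· * weight g) (hp.weight_comp_left f))

theorem isInert_associator_hom (f : X ⟶ Y) (g : Y ⟶ Z) (h : Z ⟶ Z') : IsInert (α_ f g h).hom :=
  isInert_eqToHom (Category.assoc f g h)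

theorem isInert_associator_inv (f : X ⟶ Y) (g : Y ⟶ Z) (h : Z ⟶ Z') : IsInert (α_ f g h).inv :=
  isInert_eqToHom (Category.assoc f g h).symm

theorem isInert_leftUnitor_hom (f : X ⟶ Y) : IsInert (λ_ f).hom :=
  isInert_eqToHom (Category.id_comp f)

theorem isInert_rightUnitor_inv (f : X ⟶ Y) : IsInert (ρ_ f).inv :=
  isInert_eqToHom (Category.comp_id f).symm

theorem IsInert.mu_comp_mor_paste {p : X ⟶ X'} {q : Y ⟶ Y'} {r : Z ⟶ Z'} (hp : IsPlain p)
    (hq : IsPlain q) (hr : IsPlain r) {f : X ⟶ Y} {g : Y ⟶ Z} {f' : X' ⟶ Y'} {g' : Y' ⟶ Z'}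
    {η : f ≫ q ⟶ p ≫ f'} {θ : g ≫ r ⟶ q ≫ g'} (hη : IsInert η) (hθ : IsInert θ) :
    mu f g ⊚ mor (f ◁ θ ≫ (α_ f q g').inv ≫ η ▷ g') = mu f' g' :=
  calc mu f g ⊚ mor (f ◁ θ ≫ (α_ f q g').inv ≫ η ▷ g')
      = mu f (g ≫ r) ⊚ mor (f ◁ θ) ⊚ mor (η ▷ g') := by
        rw [mor_comp, (isInert_associator_inv f q g').mor_comp_left, hr.mu_comp_right]
    _ = mu f (q ≫ g') ⊚ mor (η ▷ g') := by
        rw [← WordHom.comp_assoc (cod_mu f _) (congrArg weight (Category.assoc f q g').symm),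
          hθ.mu_comp_mor_whiskerLeft]
    _ = mu f' g' := by
        rw [← hq.mu_comp_middle, hη.mu_comp_mor_whiskerRight, hp.mu_comp_left]

theorem IsInert.paste {p : X ⟶ X'} {q : Y ⟶ Y'} {r : Z ⟶ Z'} (hp : IsPlain p) (hq : IsPlain q)
    (hr : IsPlain r) {f : X ⟶ Y} {g : Y ⟶ Z} {f' : X' ⟶ Y'} {g' : Y' ⟶ Z'}
    (h : mu f g = mu f' g') {η : f ≫ q ⟶ p ≫ f'} {θ : g ≫ r ⟶ q ≫ g'} (hη : IsInert η)
    (hθ : IsInert θ) : IsInert (f ◁ θ ≫ (α_ f q g').inv ≫ η ▷ g' ≫ (α_ p f' g').hom) := by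
  have hcod : (mu f g).cod = weight (f ≫ g ≫ r) :=
    (cod_mu f g).trans (hr.weight_comp_right (f ≫ g)).symm
  refine comp_left_cancel (mu f g) hcod hcod ?_
  rw [WordHom.comp_id hcod, ← Category.assoc (_ ◁ _), ← Category.assoc (_ ≫ _),
    Category.assoc (_ ◁ _), (isInert_associator_hom p f' g').mor_comp_right,
    hη.mu_comp_mor_paste hp hq hr hθ, h]

/-- A 2-functor on strands that has no effect on the words underlying arrows and 2-cells. -/
structure PreservesWords (F : Pseudofunctor (Strands.{v} B) (Strands.{v} B)) : Prop where
  mor_map₂ {X Y : Strands.{v} B} {f g : X ⟶ Y} (η : f ⟶ g) : mor (F.map₂ η) = mor η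
  mu_map {X Y Z : Strands.{v} B} (f : X ⟶ Y) (g : Y ⟶ Z) : mu (F.map f) (F.map g) = mu f g
  isInert_mapId (X : Strands.{v} B) : IsInert (F.mapId X).hom
  isInert_mapComp {X Y Z : Strands.{v} B} (f : X ⟶ Y) (g : Y ⟶ Z) :
    IsInert (F.mapComp f g).hom

variable {F : Pseudofunctor (Strands.{v} B) (Strands.{v} B)}

theorem PreservesWords.weight_map (hF : PreservesWords F) (f : X ⟶ Y) :
    weight (F.map f) = weight f := by
  have h := congrArg dom (hF.mor_map₂ (𝟙 f))
  rwa [dom_mor, dom_mor] at h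

theorem PreservesWords.weight_gather (hF : PreservesWords F) (f : X ⟶ Y) :
    weight (F.map f ≫ gather (F.obj Y) Y) = weight (gather (F.obj X) X ≫ f) :=
  ((isPlain_gather (F.obj Y) Y).weight_comp_right (F.map f)).trans <|
    (hF.weight_map f).trans ((isPlain_gather (F.obj X) X).weight_comp_left f).symm

/-- Gathering all labels on the first strand, as a pseudo-natural transformation. -/
noncomputable def gatherTrans (F : Pseudofunctor (Strands.{v} B) (Strands.{v} B))
    (hF : PreservesWords F) :
    Pseudofunctor.StrongTrans F (Pseudofunctor.id (Strands.{v} B)) where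
  app X := gather (F.obj X) X
  naturality f := castIso (hF.weight_gather f)
  naturality_naturality {X Y f g} η := mor_injective <| by
    refine ((isInert_castIso _).mor_comp_right _).trans
      (Eq.trans ?_ ((isInert_castIso _).mor_comp_left _).symm)
    exact ((isPlain_gather _ _).mor_whiskerRight _).trans
      ((hF.mor_map₂ η).trans ((isPlain_gather _ _).mor_whiskerLeft _).symm)
  naturality_id X := by
    have hp := isPlain_gather (F.obj X) X
    refine ((isInert_castIso _).comp ?_).eq (IsInert.comp ?_
      ((isInert_leftUnitor_hom _).comp (isInert_rightUnitor_inv _)))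
    · exact (isInert_id _).whiskerLeft (isPlain_id X) (isPlain_id X) _
    · exact (hp.mor_whiskerRight _).trans
        ((hF.isInert_mapId X).trans (congrArg WordHom.id (hp.weight_comp_right _).symm))
  naturality_comp {X Y Z} f g := by
    have hp (V) := isPlain_gather (F.obj V) V
    refine ((isInert_castIso _).comp ?_).eq (IsInert.comp ?_
      ((isInert_associator_hom _ _ _).comp ?_))
    · exact ((hp X).mor_whiskerLeft _).trans
        (congrArg WordHom.id ((hp X).weight_comp_left (f ≫ g)).symm)
    · exact ((hp Z).mor_whiskerRight _).trans
        ((hF.isInert_mapComp f g).trans (congrArg WordHom.id ((hp Z).weight_comp_right _).symm))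
    · exact .paste (hp X) (hp Y) (hp Z) (hF.mu_map f g) (isInert_castIso _) (isInert_castIso _)

theorem isInert_gatherTrans_naturality (hF : PreservesWords F) (f : X ⟶ Y) :
    IsInert ((gatherTrans F hF).naturality f).hom :=
  isInert_castIso (hF.weight_gather f)

theorem mor_id_one (X : Strands.{v} B) : mor (𝟙 (𝟙 X : X ⟶ X)) = 1 :=
  (mor_id _).trans (congrArg WordHom.id (isPlain_id X).weight_eq_one)

/-- The invertible 2-cell between two plain arrows. -/
def plainIso {p q : X ⟶ Y} (hp : IsPlain p) (hq : IsPlain q) : p ≅ q :=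
  castIso (hp.weight_eq_one.trans hq.weight_eq_one.symm)

theorem isInert_plainIso {p q : X ⟶ Y} (hp : IsPlain p) (hq : IsPlain q) :
    IsInert (plainIso hp hq).hom :=
  isInert_castIso _

theorem isEquimorphism_gather (X Y : Strands.{v} B) :
    IsEquimorphism (C := Strands.{v} B) (gather X Y) :=
  ⟨gather Y X,
    ⟨plainIso (isPlain_id X) ((isPlain_gather X Y).comp (isPlain_gather Y X))⟩,
    ⟨plainIso ((isPlain_gather Y X).comp (isPlain_gather X Y)) (isPlain_id Y)⟩⟩

/-! ### Endomorphisms of the single strand -/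

section Realization

open scoped MonoidalCategory

/-- The isomorphism `mu f g`, with the word of the product split into two. -/
noncomputable def muIso (f : StrandMap X Y) (g : StrandMap Y Z) :
    tensorWord f.weight ⊗ tensorWord g.weight ≅ tensorWord (comp f g).weight :=
  mulIso f.weight g.weight ≪≫ eqToIso (congrArg tensorWord (dom_mu f g).symm) ≪≫
    asIso (mu f g).hom ≪≫ eqToIso (congrArg tensorWord (cod_mu f g))

theorem conj_muIso (f : StrandMap X Y) (g : StrandMap Y Z) :
    conj (mulIso f.weight g.weight) (Iso.refl _) (muIso f g).hom = mu f g :=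
  conj_eqToHom_comp_hom _ _ (dom_mu f g).symm (cod_mu f g)

theorem muIso_natural {f f' : StrandMap X Y} {g g' : StrandMap Y Z}
    (η : f ⟶ f') (θ : g ⟶ g') :
    ((mor η).hom ⊗ₘ (mor θ).hom) ≫ (muIso f' g').hom =
      (muIso f g).hom ≫ (mor (hcomp η θ)).hom := by
  have left : conj (mulIso f.weight g.weight) (Iso.refl _)
      (((mor η).hom ⊗ₘ (mor θ).hom) ≫ (muIso f' g').hom) = mor η * mor θ ⊚ mu f' g' :=
    (conj_comp_conj _ (mulIso f'.weight g'.weight) _ _ _).symm.trans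
      (congrArg (mor η * mor θ ⊚ ·) (conj_muIso f' g'))
  have right : conj (mulIso f.weight g.weight) (Iso.refl _)
      ((muIso f g).hom ≫ (mor (hcomp η θ)).hom) = mu f g ⊚ mor (hcomp η θ) :=
    (conj_comp_conj _ (Iso.refl _) _ _ _).symm.trans
      (congrArg₂ WordHom.comp (conj_muIso f g) (eq_conj (mor (hcomp η θ))).symm)
  exact conj_injective _ _ (left.trans ((mu_comp_mor_hcomp η θ).symm.trans right.symm))

theorem muIso_assoc (f : StrandMap X Y) (g : StrandMap Y Z)
    (h : StrandMap Z V) :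
    (muIso f g).hom ▷ tensorWord h.weight ≫ (muIso (comp f g) h).hom =
      (α_ (tensorWord f.weight) (tensorWord g.weight) (tensorWord h.weight)).hom ≫
        tensorWord f.weight ◁ (muIso g h).hom ≫ (muIso f (comp g h)).hom := by
  have left : conj (mulIso₃ f.weight g.weight h.weight) (Iso.refl _)
      ((muIso f g).hom ▷ tensorWord h.weight ≫ (muIso (comp f g) h).hom) =
        mu f g * .id h.weight ⊚ mu (comp f g) h := by
    rw [← conj_muIso f g, ← conj_muIso (comp f g) h, conj_mul_id]
    exact (conj_comp_conj _ _ _ _ _).symm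
  have right : conj (mulIso₃ f.weight g.weight h.weight) (Iso.refl _)
      ((α_ (tensorWord f.weight) (tensorWord g.weight) (tensorWord h.weight)).hom ≫
        tensorWord f.weight ◁ (muIso g h).hom ≫ (muIso f (comp g h)).hom) =
        .id f.weight * mu g h ⊚ mu f (comp g h) := by
    rw [← conj_muIso g h, ← conj_muIso f (comp g h), id_mul_conj, conj_mulIso₃_left,
      Iso.inv_hom_id_assoc, conj_comp_conj]
  exact conj_injective _ _ (left.trans ((mu_assoc f g h).trans right.symm))

theorem id_muIso (f : StrandMap X Y) :
    (oneIso (weight_id X)).inv ▷ tensorWord f.weight ≫ (muIso (id X) f).hom =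
      (λ_ (tensorWord f.weight)).hom :=
  (Iso.inv_comp_eq (MonoidalCategory.whiskerRightIso (oneIso (weight_id X)) _)).2
    (conj_injective _ _ ((conj_muIso (id X) f).trans ((mu_id_left f).trans
      (conj_leftUnitor (weight_id X) f.weight).symm)))

theorem muIso_id (f : StrandMap X Y) :
    tensorWord f.weight ◁ (oneIso (weight_id Y)).inv ≫ (muIso f (id Y)).hom =
      (ρ_ (tensorWord f.weight)).hom :=
  (Iso.inv_comp_eq (MonoidalCategory.whiskerLeftIso _ (oneIso (weight_id Y)))).2
    (conj_injective _ _ ((conj_muIso f (id Y)).trans ((mu_id_right f).trans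
      (conj_rightUnitor (weight_id Y) f.weight).symm)))

/-- The endomorphism category of the unit, read as a category of morphisms between words. -/
def realization : EndMonoidal (unit : Strands.{v} B) ⥤ B where
  obj f := tensorWord (weight f)
  map η := (mor η).hom

/-- The isomorphisms `muIso` make `realization` a monoidal functor. -/
noncomputable def realizationCore : (realization (B := B)).CoreMonoidal where
  εIso := (oneIso (weight_id unit)).symm
  μIso f g := muIso f g
  μIso_hom_natural_left η g := by
    rw [← MonoidalCategory.tensorHom_id]
    exact muIso_natural η (𝟙 g)
  μIso_hom_natural_right f η := by
    rw [← MonoidalCategory.id_tensorHom]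
    exact muIso_natural (𝟙 f) η
  associativity f g h :=
    (congrArg (_ ≫ _ ≫ ·) (eqToHom_map realization (Category.assoc f g h))).trans
      ((congrArg (_ ≫ ·) (Category.comp_id _)).trans (muIso_assoc f g h))
  left_unitality f :=
    (id_muIso f).symm.trans (congrArg (_ ≫ ·) ((Category.comp_id _).symm.trans
      (congrArg (_ ≫ ·) (eqToHom_map realization (Category.id_comp f)).symm)))
  right_unitality f :=
    (muIso_id f).symm.trans (congrArg (_ ≫ ·) ((Category.comp_id _).symm.trans
      (congrArg (_ ≫ ·) (eqToHom_map realization (Category.comp_id f)).symm)))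

noncomputable instance : (realization (B := B)).Monoidal := realizationCore.toMonoidal

instance : (realization (B := B)).Faithful where
  map_injective h := InducedCategory.hom_ext h

instance : (realization (B := B)).Full where
  map_surjective φ := ⟨InducedCategory.homMk φ, rfl⟩

/-- Multiplication of the label of a single strand by `b`. -/
def labelled (b : B) : (unit : Strands.{v} B) ⟶ unit where
  toFun x := first unit (x.word * FreeMonoid.of b)
  lin x := .id (x.word * FreeMonoid.of b)
  dom_lin x := by simp
  cod_lin x := by simp
  isIso_lin x := inferInstance
  lin_blank := by simp

instance : (realization (B := B)).EssSurj where
  mem_essImage b := ⟨labelled b, ⟨ρ_ b⟩⟩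

instance : (realization (B := B)).IsEquivalence where

end Realization

/-! ### Juxtaposition -/

variable [BraidedCategory B]

/-- Juxtaposition of right linear maps. -/
noncomputable def tensor (f : StrandMap X Y) (g : StrandMap X' Y') :
    StrandMap (Strands.tensor X X') (Strands.tensor Y Y') where
  toFun z := pair (f z.fst) (g z.snd)
  lin z := midSwap z.fst.word z.snd.word f.weight g.weight ⊚ (f.lin z.fst * g.lin z.snd)
  dom_lin z := by
    obtain ⟨x, y, rfl⟩ := exists_pair z
    simp [weight, mul_assoc]
  cod_lin z := by rw [cod_comp (by simp [mul_assoc])]; simp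
  isIso_lin z := inferInstance
  lin_blank := by
    simp only [fst_blank, snd_blank, lin_blank, word_blank, midSwap_one_left, ← id_mul, word_pair]
    exact WordHom.comp_id (one_mul _)

theorem tensor_pair (f : StrandMap X Y) (g : StrandMap X' Y') (x : X.Labelling)
    (y : X'.Labelling) : tensor f g (pair x y) = pair (f x) (g y) := by
  simp [tensor]

theorem tensor_lin_pair (f : StrandMap X Y) (g : StrandMap X' Y') (x : X.Labelling)
    (y : X'.Labelling) : (tensor f g).lin (pair x y) =
      midSwap x.word y.word f.weight g.weight ⊚ (f.lin x * g.lin y) := by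
  simp [tensor]

theorem weight_tensor (f : StrandMap X Y) (g : StrandMap X' Y') :
    (tensor f g).weight = f.weight * g.weight := by
  simp [weight, tensor]

theorem mu_tensor (f : StrandMap X Y) (g : StrandMap X' Y') (f' : StrandMap Y Z)
    (g' : StrandMap Y' Z') : mu (tensor f g) (tensor f' g') =
      midSwap f.weight g.weight f'.weight g'.weight ⊚ (mu f f' * mu g g') := by
  rw [mu, ← pair_blank_blank, tensor_pair, tensor_lin_pair]
  rfl

theorem tensor_id : tensor (id X) (id X') = id (Strands.tensor X X') := by
  refine ext (fun z => pair_fst_snd z) fun z => ?_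
  obtain ⟨x, y, rfl⟩ := exists_pair z
  rw [tensor_lin_pair, weight_id, weight_id, midSwap_one_right]
  simp only [id, ← id_mul, word_pair, mul_one]
  exact WordHom.id_comp rfl

theorem tensor_lin_comp_tensor_lin (f : StrandMap X Y) (g : StrandMap X' Y') (f' : StrandMap Y Z)
    (g' : StrandMap Y' Z') (x : X.Labelling) (y : X'.Labelling) :
    ((tensor f g).lin (pair x y) * .id (f'.weight * g'.weight)) ⊚
        (tensor f' g').lin (pair (f x) (g y)) =
      (midSwap x.word y.word f.weight g.weight * .id (f'.weight * g'.weight)) ⊚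
        midSwap (x.word * f.weight) (y.word * g.weight) f'.weight g'.weight ⊚
        (((f.lin x * .id f'.weight) ⊚ f'.lin (f x)) *
          ((g.lin y * .id g'.weight) ⊚ g'.lin (g y))) := by
  have slide := mul_comp_midSwap (f.lin x) (g.lin y) (.id f'.weight) (.id g'.weight)
  simp only [cod_lin, dom_lin', dom_id, cod_id] at slide
  rw [tensor_lin_pair, tensor_lin_pair, comp_mul_id _ (by simp [mul_assoc]), id_mul,
    ← mul_comp_mul (by simp) (by simp),
    WordHom.comp_assoc (by simp [mul_assoc]) (by simp [mul_assoc]),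
    ← mul_assoc (f.lin x * g.lin y), ← mul_assoc (f.lin x * _),
    ← WordHom.comp_assoc (φ := f.lin x * g.lin y * _ * _) (by simp [mul_assoc])
      (by simp [mul_assoc]), slide, WordHom.comp_assoc (by simp [mul_assoc]) (by simp [mul_assoc])]

theorem id_mul_mu_tensor_comp_tensor_lin (f : StrandMap X Y) (g : StrandMap X' Y')
    (f' : StrandMap Y Z) (g' : StrandMap Y' Z') (x : X.Labelling) (y : X'.Labelling) :
    (.id (x.word * y.word) * mu (tensor f g) (tensor f' g')) ⊚
        (tensor (comp f f') (comp g g')).lin (pair x y) =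
      (.id (x.word * y.word) * midSwap f.weight g.weight f'.weight g'.weight) ⊚
        midSwap x.word y.word (f.weight * f'.weight) (g.weight * g'.weight) ⊚
        (((f.lin x * .id f'.weight) ⊚ f'.lin (f x)) *
          ((g.lin y * .id g'.weight) ⊚ g'.lin (g y))) := by
  have slide := mul_comp_midSwap (.id x.word) (.id y.word) (mu f f') (mu g g')
  simp only [dom_mu, cod_mu, dom_id, cod_id] at slide
  rw [mu_tensor, tensor_lin_pair, id_mul_comp _ (by simp [mul_assoc]),
    WordHom.comp_assoc (by simp [mul_assoc]) (by simp [mul_assoc]), ← mul_mu_comp_lin,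
    ← mul_mu_comp_lin, ← mul_comp_mul (by simp) (by simp), id_mul x.word,
    ← mul_assoc _ (mu f f') (mu g g'), ← mul_assoc (_ * mu f f'),
    ← WordHom.comp_assoc (φ := _ * mu f f' * _) (by simp [mul_assoc]) (by simp [mul_assoc]), slide,
    WordHom.comp_assoc (by simp [mul_assoc]) (by simp [mul_assoc])]

theorem tensor_comp (f : StrandMap X Y) (g : StrandMap X' Y') (f' : StrandMap Y Z)
    (g' : StrandMap Y' Z') :
    tensor (comp f f') (comp g g') = comp (tensor f g) (tensor f' g') := by
  refine ext (fun z => (tensor_pair f' g' _ _).symm) fun z => ?_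
  obtain ⟨x, y, rfl⟩ := exists_pair z
  refine comp_left_cancel (.id (pair x y).word * mu (tensor f g) (tensor f' g'))
    (by simp [weight_tensor, mul_assoc, mu_tensor, cod_comp]) (by simp) ?_
  rw [mul_mu_comp_lin, tensor_pair, word_pair, id_mul_mu_tensor_comp_tensor_lin, weight_tensor,
    tensor_lin_comp_tensor_lin,
    ← WordHom.comp_assoc (by simp [mul_assoc]) (by simp [mul_assoc]),
    ← midSwap_mul_midSwap, WordHom.comp_assoc (by simp [mul_assoc]) (by simp [mul_assoc])]

theorem tensor_assoc (f : StrandMap X Y) (g : StrandMap X' Y') (h : StrandMap X'' Y'') :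
    tensor (tensor f g) h ≍ tensor f (tensor g h) := by
  refine heq_of_forall (Strands.tensor_assoc _ _ _) (Strands.tensor_assoc _ _ _) fun z z' hz => ?_
  obtain ⟨_, w, rfl⟩ := exists_pair z
  obtain ⟨x, y, rfl⟩ := exists_pair ‹_›
  obtain rfl : z' = pair x (pair y w) := Subtype.ext (hz.symm.trans (List.append_assoc _ _ _))
  refine ⟨by simp only [tensor_pair]; exact List.append_assoc _ _ _, ?_⟩
  simp only [tensor_lin_pair, weight_tensor, word_pair]
  have left : (midSwap x.word y.word f.weight g.weight ⊚ (f.lin x * g.lin y)) * h.lin w =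
      (midSwap x.word y.word f.weight g.weight * .id (w.word * h.weight)) ⊚
        (f.lin x * g.lin y * h.lin w) := by
    rw [mul_comp_mul (by simp [mul_assoc]) (by simp), WordHom.id_comp (h.dom_lin' w)]
  have right : f.lin x * (midSwap y.word w.word g.weight h.weight ⊚ (g.lin y * h.lin w)) =
      (.id (x.word * f.weight) * midSwap y.word w.word g.weight h.weight) ⊚
        (f.lin x * (g.lin y * h.lin w)) := by
    rw [mul_comp_mul (by simp) (by simp [mul_assoc]), WordHom.id_comp (f.dom_lin' x)]
  rw [left, right, ← WordHom.comp_assoc (by simp [mul_assoc]) (by simp [mul_assoc]),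
    midSwap_comp_midSwap_mul, WordHom.comp_assoc (by simp [mul_assoc]) (by simp [mul_assoc]),
    mul_assoc (f.lin x)]

/-- Juxtaposition of 2-cells. -/
noncomputable def tensor₂ {f g : StrandMap X Y} {f' g' : StrandMap X' Y'} (η : f ⟶ g)
    (η' : f' ⟶ g') :
    tensor f f' ⟶ tensor g g' :=
  ofMor (mor η * mor η') (weight_tensor f f').symm (weight_tensor g g').symm

@[simp] theorem mor_tensor₂ {f g : StrandMap X Y} {f' g' : StrandMap X' Y'} (η : f ⟶ g)
    (η' : f' ⟶ g') : mor (tensor₂ η η') = mor η * mor η' :=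
  mor_ofMor _ _ _

theorem tensor₂_id (f : StrandMap X Y) (f' : StrandMap X' Y') :
    tensor₂ (𝟙 f) (𝟙 f') = 𝟙 (tensor f f') :=
  mor_injective (by rw [mor_tensor₂, mor_id, mor_id, mor_id, ← id_mul, weight_tensor])

theorem tensor₂_comp {f g h : StrandMap X Y} {f' g' h' : StrandMap X' Y'} (η : f ⟶ g) (θ : g ⟶ h)
    (η' : f' ⟶ g') (θ' : g' ⟶ h') :
    tensor₂ (η ≫ θ) (η' ≫ θ') = tensor₂ η η' ≫ tensor₂ θ θ' :=
  mor_injective <| by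
    simp only [mor_tensor₂, mor_comp]
    exact (mul_comp_mul rfl rfl).symm

theorem mor_tensor₂_hcomp {f g : StrandMap X Y} {h k : StrandMap Y Z} {f' g' : StrandMap X' Y'}
    {h' k' : StrandMap Y' Z'} (η : f ⟶ g) (θ : h ⟶ k) (η' : f' ⟶ g') (θ' : h' ⟶ k') :
    mor (tensor₂ (hcomp η θ) (hcomp η' θ')) = mor (hcomp (tensor₂ η η') (tensor₂ θ θ')) := by
  apply comp_left_cancel (mu (tensor f f') (tensor h h')) (by rw [cod_mu, dom_mor, tensor_comp])
    (by simp)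
  have slide := mul_comp_midSwap (mor η) (mor η') (mor θ) (mor θ')
  simp only [dom_mor, cod_mor] at slide
  rw [mu_comp_mor_hcomp, mu_tensor, mu_tensor,
    WordHom.comp_assoc (by simp [mul_assoc]) (by simp),
    mor_tensor₂, mor_tensor₂, mor_tensor₂, mul_comp_mul (by simp) (by simp), mu_comp_mor_hcomp,
    mu_comp_mor_hcomp, ← WordHom.comp_assoc (by simp [mul_assoc]) (by simp [mul_assoc]),
    ← mul_assoc (mor η * mor η'), slide,
    WordHom.comp_assoc (by simp [mul_assoc]) (by simp [mul_assoc]),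
    mul_assoc (mor η * mor θ), mul_comp_mul (by simp) (by simp)]

theorem tensor₂_assoc {f g : StrandMap X Y} {f' g' : StrandMap X' Y'}
    {f'' g'' : StrandMap X'' Y''} (η : f ⟶ g) (η' : f' ⟶ g') (η'' : f'' ⟶ g'') :
    tensor₂ (tensor₂ η η') η'' ≍ tensor₂ η (tensor₂ η' η'') :=
  heq_of_mor_eq (Strands.tensor_assoc _ _ _) (Strands.tensor_assoc _ _ _) (tensor_assoc _ _ _)
    (tensor_assoc _ _ _) (by simp only [mor_tensor₂, mul_assoc])

/-- Juxtaposition as a strict 2-functor. -/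
noncomputable def strandTensorFunctor :
    StrictPseudofunctor (Strands.{v} B × Strands.{v} B) (Strands.{v} B) :=
  .mk''
    { obj X := Strands.tensor X.1 X.2
      map f := StrandMap.tensor f.1 f.2
      map₂ η := tensor₂ η.1 η.2
      map₂_id f := tensor₂_id f.1 f.2
      map₂_comp η θ := tensor₂_comp η.1 θ.1 η.2 θ.2
      map_id X := StrandMap.tensor_id
      map_comp f g := StrandMap.tensor_comp f.1 f.2 g.1 g.2
      map₂_whisker_left f _ _ η := mor_injective <| by
        rw [mor_eqToHom_comp, mor_comp_eqToHom]
        exact (mor_tensor₂_hcomp (𝟙 f.1) η.1 (𝟙 f.2) η.2).trans (by rw [tensor₂_id]; rfl)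
      map₂_whisker_right η g := mor_injective <| by
        rw [mor_eqToHom_comp, mor_comp_eqToHom]
        exact (mor_tensor₂_hcomp η.1 (𝟙 g.1) η.2 (𝟙 g.2)).trans (by rw [tensor₂_id]; rfl) }

/-- Juxtaposition as a strictly associative tensor product. -/
noncomputable def strandTensor : StrictTensor (Strands.{v} B) where
  functor := strandTensorFunctor
  obj_assoc := Strands.tensor_assoc
  map_assoc := StrandMap.tensor_assoc
  map₂_assoc := tensor₂_assoc

theorem IsPlain.tensor {p : X ⟶ Y} {q : X' ⟶ Y'} (hp : IsPlain p) (hq : IsPlain q) :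
    IsPlain (StrandMap.tensor p q) where
  word_apply z := by
    obtain ⟨x, y, rfl⟩ := exists_pair z
    refine (congrArg word (tensor_pair p q x y)).trans ?_
    rw [word_pair, word_pair, hp.word_apply, hq.word_apply]
  apply_blank := by
    rw [← pair_blank_blank, ← pair_blank_blank, ← hp.apply_blank, ← hq.apply_blank]
    exact tensor_pair p q _ _
  lin_eq z := by
    obtain ⟨x, y, rfl⟩ := exists_pair z
    refine (tensor_lin_pair p q x y).trans ?_
    rw [hp.weight_eq_one, midSwap_one_right, hq.weight_eq_one, hp.lin_eq, hq.lin_eq, ← id_mul,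
      word_pair, mul_one, WordHom.id_comp (dom_id _)]

theorem IsInert.tensor {f g : X ⟶ Y} {f' g' : X' ⟶ Y'} {η : f ⟶ g} {η' : f' ⟶ g'}
    (hη : IsInert η) (hη' : IsInert η') : IsInert (tensor₂ η η') := by
  rw [IsInert, mor_tensor₂, hη, hη', ← id_mul, weight_tensor]

theorem mu_tensor_id_left (A : Strands.{v} B) (f : X ⟶ Y) (g : Y ⟶ Z) :
    mu (StrandMap.tensor (𝟙 A) f) (StrandMap.tensor (𝟙 A) g) = mu f g := by
  have hA : IsPlain (𝟙 A) := isPlain_id A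
  refine (mu_tensor _ _ _ _).trans ?_
  rw [hA.mu_left, hA.weight_eq_one, midSwap_one_right, id_one, one_mul, one_mul]
  exact WordHom.id_comp (dom_mu f g)

theorem mu_tensor_id_right (A : Strands.{v} B) (f : X ⟶ Y) (g : Y ⟶ Z) :
    mu (StrandMap.tensor f (𝟙 A)) (StrandMap.tensor g (𝟙 A)) = mu f g := by
  have hA : IsPlain (𝟙 A) := isPlain_id A
  refine (mu_tensor _ _ _ _).trans ?_
  rw [hA.mu_left, hA.weight_eq_one, midSwap_one_left, id_one, mul_one, mul_one]
  exact WordHom.id_comp (dom_mu f g)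

theorem preservesWords_tensorLeft (A : Strands.{v} B) :
    PreservesWords (strandTensor.tensorLeft A) where
  mor_map₂ η := (mor_tensor₂ _ η).trans <|
    (congrArg (· * mor η) (mor_id_one A)).trans (one_mul _)
  mu_map := mu_tensor_id_left A
  isInert_mapId X := ((isInert_id (𝟙 A)).tensor (isInert_id (𝟙 X))).comp
    (isInert_eqToHom (strandTensor.map_id (X := A) (Y := X)))
  isInert_mapComp f g := ((isInert_rightUnitor_inv (𝟙 A)).tensor (isInert_id (f ≫ g))).comp
    (isInert_eqToHom (strandTensor.map_comp (𝟙 A) (𝟙 A) f g))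

theorem preservesWords_tensorRight (A : Strands.{v} B) :
    PreservesWords (strandTensor.tensorRight A) where
  mor_map₂ η := (mor_tensor₂ η _).trans <|
    (congrArg (mor η * ·) (mor_id_one A)).trans (mul_one _)
  mu_map := mu_tensor_id_right A
  isInert_mapId X := ((isInert_id (𝟙 X)).tensor (isInert_id (𝟙 A))).comp
    (isInert_eqToHom (strandTensor.map_id (X := X) (Y := A)))
  isInert_mapComp f g := ((isInert_id (f ≫ g)).tensor (isInert_rightUnitor_inv (𝟙 A))).comp
    (isInert_eqToHom (strandTensor.map_comp f g (𝟙 A) (𝟙 A)))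

/-! ### The weak unit -/

section WeakUnit

open StrictTensor

/-- The left constraint of the unit. -/
noncomputable def leftUnit : Pseudofunctor.StrongTrans
    ((strandTensor (B := B)).tensorLeft unit) (Pseudofunctor.id (Strands.{v} B)) :=
  gatherTrans _ (preservesWords_tensorLeft unit)

/-- The right constraint of the unit. -/
noncomputable def rightUnit : Pseudofunctor.StrongTrans
    ((strandTensor (B := B)).tensorRight unit) (Pseudofunctor.id (Strands.{v} B)) :=
  gatherTrans _ (preservesWords_tensorRight unit)

theorem isPlain_leftUnit (X : Strands.{v} B) : IsPlain (leftUnit.app X) := isPlain_gather _ X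

theorem isPlain_rightUnit (X : Strands.{v} B) : IsPlain (rightUnit.app X) := isPlain_gather _ X

theorem isInert_leftUnit_naturality (f : X ⟶ Y) : IsInert (leftUnit.naturality f).hom :=
  isInert_gatherTrans_naturality (preservesWords_tensorLeft unit) f

theorem isInert_rightUnit_naturality (f : X ⟶ Y) : IsInert (rightUnit.naturality f).hom :=
  isInert_gatherTrans_naturality (preservesWords_tensorRight unit) f

theorem isPlain_rightUnit_tensor (X Y : Strands.{v} B) :
    IsPlain (strandTensor.map (rightUnit.app X) (𝟙 Y)) :=
  (isPlain_rightUnit X).tensor (isPlain_id Y)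

theorem isPlain_leftUnit_tensor (X Y : Strands.{v} B) :
    IsPlain (strandTensor.map (leftUnit.app X) (𝟙 Y)) :=
  (isPlain_leftUnit X).tensor (isPlain_id Y)

theorem isPlain_assoc_tensor_leftUnit (X Y : Strands.{v} B) :
    IsPlain (strandTensor.assoc X unit Y ≫ strandTensor.map (𝟙 X) (leftUnit.app Y)) :=
  (isPlain_eqToHom _).comp ((isPlain_id X).tensor (isPlain_leftUnit Y))

theorem isPlain_assoc_leftUnit (X Y : Strands.{v} B) :
    IsPlain (strandTensor.assoc unit X Y ≫ leftUnit.app (strandTensor.obj X Y)) :=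
  (isPlain_eqToHom _).comp (isPlain_leftUnit _)

theorem isPlain_assoc_tensor_rightUnit (X Y : Strands.{v} B) :
    IsPlain (strandTensor.assoc X Y unit ≫ strandTensor.map (𝟙 X) (rightUnit.app Y)) :=
  (isPlain_eqToHom _).comp ((isPlain_id X).tensor (isPlain_rightUnit Y))

/-- The 2-cell `ρ_X ⊗ Y ⇒ X ⊗ λ_Y`. -/
noncomputable def kelly (X Y : Strands.{v} B) : strandTensor.map (rightUnit.app X) (𝟙 Y) ≅
    strandTensor.assoc X unit Y ≫ strandTensor.map (𝟙 X) (leftUnit.app Y) :=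
  plainIso (isPlain_rightUnit_tensor X Y) (isPlain_assoc_tensor_leftUnit X Y)

/-- The 2-cell `λ_{X ⊗ Y} ⇒ λ_X ⊗ Y`. -/
noncomputable def leftCell (X Y : Strands.{v} B) :
    strandTensor.assoc unit X Y ≫ leftUnit.app (strandTensor.obj X Y) ≅
      strandTensor.map (leftUnit.app X) (𝟙 Y) :=
  plainIso (isPlain_assoc_leftUnit X Y) (isPlain_leftUnit_tensor X Y)

/-- The 2-cell `ρ_{X ⊗ Y} ⇒ X ⊗ ρ_Y`. -/
noncomputable def rightCell (X Y : Strands.{v} B) : rightUnit.app (strandTensor.obj X Y) ≅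
    strandTensor.assoc X Y unit ≫ strandTensor.map (𝟙 X) (rightUnit.app Y) :=
  plainIso (isPlain_rightUnit _) (isPlain_assoc_tensor_rightUnit X Y)

theorem isInert_kelly (X Y : Strands.{v} B) : IsInert (kelly X Y).hom := isInert_plainIso _ _

theorem isInert_leftCell (X Y : Strands.{v} B) : IsInert (leftCell X Y).hom :=
  isInert_plainIso _ _

theorem isInert_rightCell (X Y : Strands.{v} B) : IsInert (rightCell X Y).hom :=
  isInert_plainIso _ _

theorem kelly_natural (f : X ⟶ X') (g : Y ⟶ Y') :
    TwoCell.Square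
      ⟨strandTensor.map₂ (rightUnit.naturality f).hom (𝟙 g)⟩
      ⟨(kelly X Y).hom ▷ strandTensor.map f g⟩
      ⟨strandTensor.map (strandTensor.map f (𝟙 unit)) g ◁ (kelly X' Y').hom⟩
      ⟨strandTensor.map₂ (𝟙 f) (leftUnit.naturality g).hom⟩ :=
  IsInert.twoCellSquare
    ((isInert_rightUnit_naturality f).tensor (isInert_id g))
    ((isInert_kelly X Y).whiskerRight
      (isPlain_rightUnit_tensor X Y) (isPlain_assoc_tensor_leftUnit X Y) _)
    ((isInert_kelly X' Y').whiskerLeft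
      (isPlain_rightUnit_tensor X' Y') (isPlain_assoc_tensor_leftUnit X' Y') _)
    ((isInert_id f).tensor (isInert_leftUnit_naturality g))
    (congrArg Arrow.mk (map_comp_left _ _ _ _).symm)
    (congrArg Arrow.mk (map_comp_left' _ _ _ _))
    (arrow_map_comp_assoc_comp_map _ _ _ _ _)
    ((congrArg Arrow.mk (map_comp_right' _ _ _ _)).trans (arrow_assoc_comp_map _ _ _ _).symm)

theorem leftCell_natural (f : X ⟶ X') (g : Y ⟶ Y') :
    TwoCell.Square
      ⟨(leftUnit.naturality (strandTensor.map f g)).hom⟩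
      ⟨(leftCell X Y).hom ▷ strandTensor.map f g⟩
      ⟨strandTensor.map (strandTensor.map (𝟙 unit) f) g ◁ (leftCell X' Y').hom⟩
      ⟨strandTensor.map₂ (leftUnit.naturality f).hom (𝟙 g)⟩ :=
  IsInert.twoCellSquare
    (isInert_leftUnit_naturality _)
    ((isInert_leftCell X Y).whiskerRight
      (isPlain_assoc_leftUnit X Y) (isPlain_leftUnit_tensor X Y) _)
    ((isInert_leftCell X' Y').whiskerLeft
      (isPlain_assoc_leftUnit X' Y') (isPlain_leftUnit_tensor X' Y') _)
    ((isInert_leftUnit_naturality f).tensor (isInert_id g))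
    (arrow_map_comp_assoc _ _ _ _ _)
    ((congrArg Arrow.mk (Category.assoc _ _ _)).trans (Arrow.arrow_mk_eqToHom_comp _ _)).symm
    (congrArg Arrow.mk (map_comp_left _ _ _ _).symm)
    (congrArg Arrow.mk (map_comp_left' _ _ _ _))

theorem rightCell_natural (f : X ⟶ X') (g : Y ⟶ Y') :
    TwoCell.Square
      ⟨(rightUnit.naturality (strandTensor.map f g)).hom⟩
      ⟨(rightCell X Y).hom ▷ strandTensor.map f g⟩
      ⟨strandTensor.map (strandTensor.map f g) (𝟙 unit) ◁ (rightCell X' Y').hom⟩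
      ⟨strandTensor.map₂ (𝟙 f) (rightUnit.naturality g).hom⟩ :=
  IsInert.twoCellSquare
    (isInert_rightUnit_naturality _)
    ((isInert_rightCell X Y).whiskerRight
      (isPlain_rightUnit _) (isPlain_assoc_tensor_rightUnit X Y) _)
    ((isInert_rightCell X' Y').whiskerLeft
      (isPlain_rightUnit _) (isPlain_assoc_tensor_rightUnit X' Y') _)
    ((isInert_id f).tensor (isInert_rightUnit_naturality g))
    rfl
    rfl
    (arrow_map_comp_assoc_comp_map _ _ _ _ _)
    ((congrArg Arrow.mk (map_comp_right' _ _ _ _)).trans (arrow_assoc_comp_map _ _ _ _).symm)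

theorem left_normalised (X Y Z : Strands.{v} B) :
    TwoCell.Comp
      ⟨(kelly X (strandTensor.obj Y Z)).hom⟩
      ⟨strandTensor.map₂ (𝟙 (𝟙 X)) (leftCell Y Z).hom⟩
      ⟨strandTensor.map₂ (kelly X Y).hom (𝟙 (𝟙 Z))⟩ :=
  IsInert.twoCellComp
    (isInert_kelly X _)
    ((isInert_id (𝟙 X)).tensor (isInert_leftCell Y Z))
    ((isInert_kelly X Y).tensor (isInert_id (𝟙 Z)))
    (by rw [arrow_map_assoc, map_id])
    ((Arrow.arrow_mk_eqToHom_comp _ _).trans (arrow_map_eqToHom_comp_right _ _ _ _).symm)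
    ((arrow_map_assoc _ _ _ _).symm.trans (arrow_map_eqToHom_comp_left _ _ _ _).symm)

theorem right_normalised (X Y Z : Strands.{v} B) :
    TwoCell.Comp
      ⟨strandTensor.map₂ (rightCell X Y).hom (𝟙 (𝟙 Z))⟩
      ⟨strandTensor.map₂ (𝟙 (𝟙 X)) (kelly Y Z).hom⟩
      ⟨(kelly (strandTensor.obj X Y) Z).hom⟩ :=
  IsInert.twoCellComp
    ((isInert_rightCell X Y).tensor (isInert_id (𝟙 Z)))
    ((isInert_id (𝟙 X)).tensor (isInert_kelly Y Z))
    (isInert_kelly _ Z)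
    rfl
    ((arrow_map_eqToHom_comp_left _ _ _ _).trans (arrow_map_assoc _ _ _ _))
    ((arrow_map_eqToHom_comp_right _ _ _ _).trans <| (arrow_map_assoc _ _ _ _).symm.trans <|
      (congrArg (fun k => Arrow.mk (strandTensor.map k (leftUnit.app Z))) (map_id _)).trans
        (Arrow.arrow_mk_eqToHom_comp _ _).symm)

/-- The weak unit of the 2-category of strands. -/
noncomputable def weakUnit : WeakUnit (strandTensor (B := B)) where
  unit := unit
  left := leftUnit
  left_equi X := isEquimorphism_gather _ X
  right := rightUnit
  right_equi X := isEquimorphism_gather _ X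
  kelly := kelly
  leftCell := leftCell
  rightCell := rightCell
  kelly_natural := kelly_natural
  leftCell_natural := leftCell_natural
  rightCell_natural := rightCell_natural
  left_normalised := left_normalised
  right_normalised := right_normalised

end WeakUnit

/-! ### The canonical braiding -/

/-- The comparison of the two unit constraints at the unit. -/
noncomputable def kappa : rightUnit.app (unit : Strands.{v} B) ≅ leftUnit.app unit :=
  plainIso (isPlain_rightUnit unit) (isPlain_leftUnit unit)

theorem isInert_kappa : IsInert (kappa (B := B)).hom := isInert_plainIso _ _

theorem isCanonicalKappa : (weakUnit (B := B)).IsCanonicalKappa kappa := by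
  refine IsInert.eq (((isInert_kappa (B := B)).tensor (isInert_id (𝟙 unit))).whiskerRight
    (isPlain_rightUnit_tensor _ _) (isPlain_leftUnit_tensor _ _) _) ?_
  refine IsInert.comp (IsInert.whiskerRight (isInert_kelly unit unit)
    (isPlain_rightUnit_tensor _ _) (isPlain_assoc_tensor_leftUnit _ _) _) ?_
  refine (isInert_associator_hom _ _ _).comp (IsInert.comp ?_ ((isInert_associator_inv _ _ _).comp
    ((isInert_leftCell unit unit).whiskerRight
      (isPlain_assoc_leftUnit _ _) (isPlain_leftUnit_tensor _ _) _)))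
  exact (isInert_leftUnit_naturality (leftUnit.app unit)).whiskerLeft
    (((isPlain_id unit).tensor (isPlain_leftUnit unit)).comp (isPlain_leftUnit unit))
    ((isPlain_leftUnit _).comp (isPlain_leftUnit unit)) _

theorem isInert_leftStrand (g : (unit : Strands.{v} B) ⟶ unit) :
    IsInert (weakUnit.leftStrand kappa g).hom :=
  ((isInert_kappa (B := B)).inv.whiskerLeft
    (isPlain_leftUnit unit) (isPlain_rightUnit unit) _).comp
    ((isInert_rightUnit_naturality g).comp
      (isInert_kappa.whiskerRight (isPlain_rightUnit unit) (isPlain_leftUnit unit) g))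

section Exchange

variable (f g : (unit : Strands.{v} B) ⟶ unit)

theorem mu_tensor_id_left_id_right :
    mu (strandTensor.map (𝟙 unit) f) (strandTensor.map g (𝟙 unit)) = swap f.weight g.weight := by
  have hI : IsPlain (𝟙 (unit : Strands.{v} B)) := isPlain_id unit
  refine (mu_tensor _ _ _ _).trans ?_
  rw [hI.mu_left, hI.mu_right, hI.weight_eq_one, midSwap, id_one, one_mul, mul_one, ← id_mul]
  exact WordHom.comp_id (cod_swap _ _)

theorem mu_tensor_id_right_id_left :
    mu (strandTensor.map g (𝟙 unit)) (strandTensor.map (𝟙 unit) f) = .id (g.weight * f.weight) := by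
  have hI : IsPlain (𝟙 (unit : Strands.{v} B)) := isPlain_id unit
  refine (mu_tensor _ _ _ _).trans ?_
  rw [hI.mu_left, hI.mu_right, hI.weight_eq_one, midSwap_one_right, mul_one, ← id_mul]
  exact WordHom.id_comp (dom_id _)

theorem swap_comp_mor_pasteIso :
    swap f.weight g.weight ⊚
      mor (pasteIso (weakUnit.rightStrand f) (weakUnit.leftStrand kappa g)).hom = mu f g := by
  have hα : IsPlain (leftUnit.app (unit : Strands.{v} B)) := isPlain_leftUnit unit
  rw [← mu_tensor_id_left_id_right]
  exact (isInert_leftUnit_naturality f).mu_comp_mor_paste hα hα hα (isInert_leftStrand g)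

theorem mor_pasteIso :
    mor (pasteIso (weakUnit.leftStrand kappa g) (weakUnit.rightStrand f)).hom = mu g f := by
  have hα : IsPlain (leftUnit.app (unit : Strands.{v} B)) := isPlain_leftUnit unit
  have h := (isInert_leftStrand g).mu_comp_mor_paste hα hα hα (isInert_leftUnit_naturality f)
  have hmu := mu_tensor_id_right_id_left f g
  have hdom : weight (strandTensor.map g (𝟙 unit) ≫ strandTensor.map (𝟙 unit) f ≫
      leftUnit.app unit) = g.weight * f.weight :=
    (hα.weight_comp_right (strandTensor.map g (𝟙 unit) ≫ strandTensor.map (𝟙 unit) f)).trans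
      ((cod_mu _ _).symm.trans (congrArg cod hmu))
  exact (WordHom.id_comp hdom).symm.trans ((congrArg (· ⊚ _) hmu).symm.trans h)

theorem mor_exchange :
    mor (weakUnit.exchange kappa f g).hom =
      mor (pasteIso (weakUnit.rightStrand f) (weakUnit.leftStrand kappa g)).inv ⊚ mu g f := by
  have hα : IsPlain (leftUnit.app (unit : Strands.{v} B)) := isPlain_leftUnit unit
  have hinterchange : IsInert
      (eqToHom (strandTensor.interchange g f) ▷ leftUnit.app (unit : Strands.{v} B)) :=
    (hα.mor_whiskerRight _).trans
      ((isInert_eqToHom _).trans (congrArg WordHom.id (hα.weight_comp_right _).symm))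
  refine (congrArg (fun i : _ ≅ _ => mor i.hom)
    (WeakUnit.exchange_eq weakUnit kappa f g)).trans ?_
  refine ((isInert_associator_inv _ _ _).mor_comp_left _).trans ?_
  refine (mor_comp _ _).trans (congrArg _ ?_)
  refine (((isInert_associator_inv _ _ _).comp
    (hinterchange.comp (isInert_associator_hom _ _ _))).mor_comp_left _).trans ?_
  exact ((isInert_associator_hom _ _ _).mor_comp_right _).trans (mor_pasteIso f g)

theorem mu_comp_mor_exchange :
    mu f g ⊚ mor (weakUnit.exchange kappa f g).hom = swap f.weight g.weight ⊚ mu g f := by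
  have hcod : (swap f.weight g.weight).cod =
      weight (strandTensor.map (𝟙 unit) f ≫ strandTensor.map g (𝟙 unit) ≫ leftUnit.app unit) :=
    (congrArg cod (mu_tensor_id_left_id_right f g)).symm.trans ((cod_mu _ _).trans
      ((isPlain_leftUnit unit).weight_comp_right (strandTensor.map (𝟙 unit) f ≫ _)).symm)
  have hpaste : mu f g ⊚
      mor (pasteIso (weakUnit.rightStrand f) (weakUnit.leftStrand kappa g)).inv =
        swap f.weight g.weight :=
    (congrArg (· ⊚ _) (swap_comp_mor_pasteIso f g)).symm.trans (comp_mor_inv _ hcod)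
  rw [mor_exchange, ← WordHom.comp_assoc, hpaste]
  · exact (cod_mu f g).trans ((isPlain_leftUnit unit).weight_comp_left (f ≫ g)).symm
  · exact hcod.symm.trans ((cod_swap _ _).trans (dom_mu g f).symm)

end Exchange

section Braiding

open scoped MonoidalCategory

/-- The braiding of `B`, transported along the equivalence `realization`. -/
noncomputable instance endBraided : BraidedCategory (EndMonoidal (unit : Strands.{v} B)) :=
  .ofFullyFaithful realization

noncomputable instance instBraidedRealization : (realization (B := B)).Braided where
  braided f g := by
    simp +instances [endBraided, BraidedCategory.ofFullyFaithful, BraidedCategory.ofFaithful]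

theorem conj_tensorator_comp_map (f g : EndMonoidal (unit : Strands.{v} B))
    {h : EndMonoidal (unit : Strands.{v} B)} (η : f ⊗ g ⟶ h) :
    conj (mulIso (weight f) (weight g)) (Iso.refl _)
      (Functor.LaxMonoidal.μ realization f g ≫ realization.map η) = mu f g ⊚ mor η :=
  (conj_comp_conj _ (Iso.refl _) _ _ _).symm.trans
    (congrArg₂ WordHom.comp (conj_muIso f g) (eq_conj (mor η)).symm)

theorem mu_comp_mor_braiding (f g : EndMonoidal (unit : Strands.{v} B)) :
    mu f g ⊚ mor (β_ f g).hom = swap (weight f) (weight g) ⊚ mu g f :=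
  (conj_tensorator_comp_map f g _).symm.trans
    ((congrArg (conj _ _) (Functor.LaxBraided.braided (F := realization) f g)).trans
      ((conj_comp_conj _ (mulIso (weight g) (weight f)) _ _ _).symm.trans
        (congrArg (swap (weight f) (weight g) ⊚ ·) (conj_muIso g f))))

theorem isCanonicalBraiding : (weakUnit (B := B)).IsCanonicalBraiding endBraided := by
  refine ⟨kappa, isCanonicalKappa, fun f g => mor_injective ?_⟩
  have hα : IsPlain (leftUnit.app (unit : Strands.{v} B)) := isPlain_leftUnit unit
  exact (hα.mor_whiskerLeft _).trans (comp_left_cancel (mu f g) (cod_mu f g)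
    ((cod_mu f g).trans (hα.weight_comp_left (f ≫ g)).symm)
    ((mu_comp_mor_braiding f g).trans (mu_comp_mor_exchange f g).symm))

theorem exists_braided_equivalence : ∃ F : B ⥤ EndMonoidal (unit : Strands.{v} B),
    F.IsEquivalence ∧ Nonempty F.Braided := by
  let e := (realization (B := B)).asEquivalence
  have : e.functor.Braided := instBraidedRealization
  exact ⟨e.inverse, inferInstance, nonempty_braided_inverse e⟩

end Braiding

end StrandMap

theorem theorem7p1 (B : Type u) [Category.{v} B] [MonoidalCategory B] [BraidedCategory B] :
    ∃ (C : Type (max u v)) (_ : Bicategory.{v, max u v} C) (_ : Bicategory.Strict C)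
      (T : StrictTensor C) (W : WeakUnit T) (β : BraidedCategory (EndMonoidal W.unit)),
      W.IsCanonicalBraiding β ∧
        ∃ F : B ⥤ EndMonoidal W.unit, F.IsEquivalence ∧ Nonempty F.Braided :=
  ⟨Strands.{v} B, inferInstance, inferInstance, StrandMap.strandTensor, StrandMap.weakUnit,
    StrandMap.endBraided, StrandMap.isCanonicalBraiding, StrandMap.exists_braided_equivalence⟩
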